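/- Let $\mathbf{O}$ be the octonions, with conjugation $\overline{x}$ and inner product $(x|y)$, and let $\mathcal{J}^1$ be the $27$-dimensional real Jordan algebra of all matrices $$h^1(\xi_1,\xi_2,\xi_3;x_1,x_2,x_3)=\begin{pmatrix}\xi_1&\sqrt{-1}\,x_3&\sqrt{-1}\,\overline{x_2}\\ \sqrt{-1}\,\overline{x_3}&\xi_2&x_1\\ \sqrt{-1}\,x_2&\overline{x_1}&\xi_3\end{pmatrix}\qquad(\xi_i\in\mathbb{R},\ x_i\in\mathbf{O})$$ with product $X\circ Y=\tfrac12(XY+YX)$, $\mathrm{tr}(X)=\xi_1+\xi_2+\xi_3$, $(X|Y)=\mathrm{tr}(X\circ Y)$ and, with $E$ the unit element, $X\times Y=\tfrac12\bigl(2X\circ Y-\mathrm{tr}(X)Y-\mathrm{tr}(Y)X+(\mathrm{tr}(X)\mathrm{tr}(Y)-(X|Y))E\bigr)$. Let $E_i$ be the diagonal idempotents, $F_3^1(x)=h^1(0,0,0;0,0,x)$ and $P^-=h^1(-1,1,0;0,0,1)$. Let $\mathrm{F}_{4(-20)}=\{g\in \mathrm{GL}_{\mathbb{R}}(\mathcal{J}^1)\mid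 g(X\circ Y)=gX\circ gY\}$, with Lie algebra $\mathfrak{f}_{4(-20)}$ the derivations of $\mathcal{J}^1$. Let $\sigma\in\mathrm{F}_{4(-20)}$ be $h^1(\xi_1,\xi_2,\xi_3;x_1,x_2,x_3)\mapsto h^1(\xi_1,\xi_2,\xi_3;x_1,-x_2,-x_3)$ and $K=\{g\in\mathrm{F}_{4(-20)}\mid\sigma g\sigma^{-1}=g\}$. Let $\tilde A=\tilde A_3^1(1)\in\mathfrak{f}_{4(-20)}$ be the derivation $$h^1(\xi_1,\xi_2,\xi_3;x_1,x_2,x_3)\mapsto h^1\bigl(-2(1|x_3),\,2(1|x_3),\,0;\ \overline{x_2},\,\overline{x_1},\,\xi_2-\xi_1\bigr),$$ and put $A=\{\exp(t\tilde A)\mid t\in\mathbb{R}\}$, $M=\{k\in K\mid k\tilde Ak^{-1}=\tilde A\}$, $\mathfrak{g}_{c\alpha}=\{D\in\mathfrak{f}_{4(-20)}\mid[\tilde A,D]=cD\}$ for $c=1,2$, and $N^+=\exp(\mathfrak{g}_{\alpha}\oplus\mathfrak{g}_{2\alpha})$. Let $\mathrm{Spin}(9)$ denote the stabilizer of $E_1$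 in $\mathrm{F}_{4(-20)}$ and $\mathrm{Spin}(7)$ the pointwise stabilizer of $E_1,E_2,E_3,F_3^1(1)$. Let $\mathcal{N}_1^-=\{X\in\mathcal{J}^1\mid X\times X=0,\ \mathrm{tr}(X)=0,\ (E_1|X)<0\}$ and $\mathcal{F}=\mathcal{N}_1^- /\mathbb{R}_{>0}$, with the quotient topology; write $[X]$ for the class of $X$. The group $\mathrm{F}_{4(-20)}$ acts on $\mathcal{F}$ by $g[X]=[gX]$. Theorem. 1. The stabilizer of $[P^-]$ in $\mathrm{F}_{4(-20)}$ is $MAN^+$. 2. $MAN^+$ is a subgroup of $\mathrm{F}_{4(-20)}$, and $g\,MAN^+\mapsto g[P^-]$ is a well-defined homeomorphism $\mathrm{F}_{4(-20)}/MAN^+\simeq\mathcal{F}$. 3. $K$ acts transitively on $\mathcal{F}$: $\mathcal{F}=K\cdot[P^-]$. 4. $\mathrm{Spin}(7)\subset\mathrm{Spin}(9)$, and $k\,\mathrm{Spin}(7)\mapsto k[P^-]$ is a well-defined homeomorphism $\mathrm{Spin}(9)/\mathrm{Spin}(7)\simeq\mathcal{F}$. -/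

import Mathlib

open scoped Quaternion Pointwise

noncomputable section

namespace ExcF4

/-! ## Octonions -/

/-- The real octonions, by the Cayley-Dickson doubling of the quaternions. -/
def Octonion : Type := ℍ[ℝ] × ℍ[ℝ]

namespace Octonion

/-- The norm is only used for the topology of this finite-dimensional real vector space. -/
instance : NormedAddCommGroup Octonion := inferInstanceAs (NormedAddCommGroup (ℍ[ℝ] × ℍ[ℝ]))

instance : NormedSpace ℝ Octonion := inferInstanceAs (NormedSpace ℝ (ℍ[ℝ] × ℍ[ℝ]))

instance : FiniteDimensional ℝ Octonion :=
  inferInstanceAs (FiniteDimensional ℝ (ℍ[ℝ] × ℍ[ℝ]))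

instance : One Octonion := ⟨((1 : ℍ[ℝ]), (0 : ℍ[ℝ]))⟩

/-- `(a, b) (c, d) = (a c - d̄ b, d a + b c̄)`. -/
instance : Mul Octonion :=
  ⟨fun x y => (x.1 * y.1 - star y.2 * x.2, y.2 * x.1 + x.2 * star y.1)⟩

/-- The conjugation of the octonions. -/
def conj (x : Octonion) : Octonion := (star x.1, -x.2)

/-- The inner product `(x|y)`, for which the units `1, e₁, …, e₇` are orthonormal. -/
def ip (x y : Octonion) : ℝ := (x.1 * star y.1).re + (x.2 * star y.2).re

theorem ext' {x y : Octonion} (h1 : x.1 = y.1) (h2 : x.2 = y.2) : x = y := Prod.ext h1 h2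

theorem ext8 {x y : Octonion} (h1 : x.1.re = y.1.re) (h2 : x.1.imI = y.1.imI)
    (h3 : x.1.imJ = y.1.imJ) (h4 : x.1.imK = y.1.imK) (h5 : x.2.re = y.2.re)
    (h6 : x.2.imI = y.2.imI) (h7 : x.2.imJ = y.2.imJ) (h8 : x.2.imK = y.2.imK) : x = y :=
  ext' (QuaternionAlgebra.ext h1 h2 h3 h4) (QuaternionAlgebra.ext h5 h6 h7 h8)

theorem add_fst (x y : Octonion) : (x + y).1 = x.1 + y.1 := rfl
theorem add_snd (x y : Octonion) : (x + y).2 = x.2 + y.2 := rfl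
theorem sub_fst (x y : Octonion) : (x - y).1 = x.1 - y.1 := rfl
theorem sub_snd (x y : Octonion) : (x - y).2 = x.2 - y.2 := rfl
theorem neg_fst (x : Octonion) : (-x).1 = -x.1 := rfl
theorem neg_snd (x : Octonion) : (-x).2 = -x.2 := rfl
theorem smul_fst (r : ℝ) (x : Octonion) : (r • x).1 = r • x.1 := rfl
theorem smul_snd (r : ℝ) (x : Octonion) : (r • x).2 = r • x.2 := rfl
theorem zero_fst : (0 : Octonion).1 = 0 := rfl
theorem zero_snd : (0 : Octonion).2 = 0 := rfl
theorem one_fst : (1 : Octonion).1 = 1 := rfl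
theorem one_snd : (1 : Octonion).2 = 0 := rfl
theorem mul_fst (x y : Octonion) : (x * y).1 = x.1 * y.1 - star y.2 * x.2 := rfl
theorem mul_snd (x y : Octonion) : (x * y).2 = y.2 * x.1 + x.2 * star y.1 := rfl
theorem conj_fst (x : Octonion) : (conj x).1 = star x.1 := rfl
theorem conj_snd (x : Octonion) : (conj x).2 = -x.2 := rfl

attribute [simp] add_fst add_snd sub_fst sub_snd neg_fst neg_snd smul_fst smul_snd zero_fst
  zero_snd one_fst one_snd mul_fst mul_snd conj_fst conj_snd

theorem ip_self_nonneg (x : Octonion) : 0 ≤ ip x x := by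
  simp [ip]; nlinarith [sq_nonneg x.1.re, sq_nonneg x.1.imI, sq_nonneg x.1.imJ,
    sq_nonneg x.1.imK, sq_nonneg x.2.re, sq_nonneg x.2.imI, sq_nonneg x.2.imJ,
    sq_nonneg x.2.imK]

theorem eq_zero_of_ip_self {x : Octonion} (h : ip x x = 0) : x = 0 := by
  simp [ip] at h
  refine ext8 ?_ ?_ ?_ ?_ ?_ ?_ ?_ ?_ <;> simp <;>
  nlinarith [sq_nonneg x.1.re, sq_nonneg x.1.imI, sq_nonneg x.1.imJ,
    sq_nonneg x.1.imK, sq_nonneg x.2.re, sq_nonneg x.2.imI, sq_nonneg x.2.imJ,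
    sq_nonneg x.2.imK]

theorem ip_mul_self (x y : Octonion) : ip (x * y) (x * y) = ip x x * ip y y := by
  simp [ip]; ring

theorem conj_mul_mul (x y : Octonion) : conj x * conj y * y = ip y y • conj x := by
  refine ext8 ?_ ?_ ?_ ?_ ?_ ?_ ?_ ?_ <;> simp [ip] <;> ring

theorem smul_one_mul (r : ℝ) (x : Octonion) : (r • (1 : Octonion)) * x = r • x := by
  refine ext8 ?_ ?_ ?_ ?_ ?_ ?_ ?_ ?_ <;> simp

theorem mul_smul_one (r : ℝ) (x : Octonion) : x * (r • (1 : Octonion)) = r • x := by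
  refine ext8 ?_ ?_ ?_ ?_ ?_ ?_ ?_ ?_ <;> simp

theorem conj_mul (x y : Octonion) : conj (x * y) = conj y * conj x := by
  refine ext8 ?_ ?_ ?_ ?_ ?_ ?_ ?_ ?_ <;> simp

theorem conj_conj (x : Octonion) : conj (conj x) = x := ext' (by simp) (by simp)

theorem conj_add (x y : Octonion) : conj (x + y) = conj x + conj y :=
  ext' (by simp) (by simp; abel)

theorem conj_sub (x y : Octonion) : conj (x - y) = conj x - conj y :=
  ext' (by simp) (by simp; abel)

theorem conj_smul (r : ℝ) (x : Octonion) : conj (r • x) = r • conj x :=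
  ext' (by simp) (by simp)

theorem conj_zero : conj 0 = 0 := ext' (by simp) (by simp)

theorem mul_conj_add (x y : Octonion) : x * conj y + y * conj x = (2 * ip x y) • 1 := by
  refine ext8 ?_ ?_ ?_ ?_ ?_ ?_ ?_ ?_ <;> simp [ip] <;> ring

theorem conj_mul_add (x y : Octonion) : conj x * y + conj y * x = (2 * ip x y) • 1 := by
  refine ext8 ?_ ?_ ?_ ?_ ?_ ?_ ?_ ?_ <;> simp [ip] <;> ring

end Octonion

/-- The complexified octonions; the pair `(x, y)` is `x + √-1 y`. -/
def COctonion : Type := Octonion × Octonion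

namespace COctonion

instance : AddCommGroup COctonion := inferInstanceAs (AddCommGroup (Octonion × Octonion))

instance : Module ℝ COctonion := inferInstanceAs (Module ℝ (Octonion × Octonion))

instance : Mul COctonion := ⟨fun z w => (z.1 * w.1 - z.2 * w.2, z.1 * w.2 + z.2 * w.1)⟩

/-- `x + √-1 y`. -/
def mk (x y : Octonion) : COctonion := (x, y)

end COctonion

/-! ## The exceptional Jordan algebra -/

/-- The underlying space of the exceptional Jordan algebra `𝒥¹`: the pair `(ξ, x)` stands for
`h¹(ξ₁, ξ₂, ξ₃; x₁, x₂, x₃)`, with indices shifted to `0, 1, 2`. -/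
abbrev J1 : Type := (Fin 3 → ℝ) × (Fin 3 → Octonion)

/-- The element `h¹(ξ₁, ξ₂, ξ₃; x₁, x₂, x₃)`. -/
def h1 (ξ₁ ξ₂ ξ₃ : ℝ) (x₁ x₂ x₃ : Octonion) : J1 := (![ξ₁, ξ₂, ξ₃], ![x₁, x₂, x₃])

open Octonion in
/-- The matrix with entries in the complexified octonions which the element
`h¹(ξ₁, ξ₂, ξ₃; x₁, x₂, x₃)` denotes. -/
def toMat (X : J1) : Matrix (Fin 3) (Fin 3) COctonion :=
  !![.mk (X.1 0 • 1) 0, .mk 0 (X.2 2), .mk 0 (conj (X.2 1));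
     .mk 0 (conj (X.2 2)), .mk (X.1 1 • 1) 0, .mk (X.2 0) 0;
     .mk 0 (X.2 1), .mk (conj (X.2 0)) 0, .mk (X.1 2 • 1) 0]

open Octonion in
/-- The Jordan product `X ∘ Y = (X Y + Y X) / 2`, in coordinates; see `toMat_jordan`. -/
def jordan (X Y : J1) : J1 :=
  h1 (X.1 0 * Y.1 0 - ip (X.2 1) (Y.2 1) - ip (X.2 2) (Y.2 2))
    (X.1 1 * Y.1 1 + ip (X.2 0) (Y.2 0) - ip (X.2 2) (Y.2 2))
    (X.1 2 * Y.1 2 + ip (X.2 0) (Y.2 0) - ip (X.2 1) (Y.2 1))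
    ((2⁻¹ : ℝ) • ((X.1 1 + X.1 2) • Y.2 0 + (Y.1 1 + Y.1 2) • X.2 0
      - conj (X.2 1 * Y.2 2) - conj (Y.2 1 * X.2 2)))
    ((2⁻¹ : ℝ) • ((X.1 2 + X.1 0) • Y.2 1 + (Y.1 2 + Y.1 0) • X.2 1
      + conj (X.2 2 * Y.2 0) + conj (Y.2 2 * X.2 0)))
    ((2⁻¹ : ℝ) • ((X.1 0 + X.1 1) • Y.2 2 + (Y.1 0 + Y.1 1) • X.2 2
      + conj (X.2 0 * Y.2 1) + conj (Y.2 0 * X.2 1)))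

open Octonion in
theorem toMat_jordan (X Y : J1) :
    toMat (jordan X Y) = (2⁻¹ : ℝ) • (toMat X * toMat Y + toMat Y * toMat X) := by
  have hm : ∀ a b c d : Octonion, COctonion.mk a b * COctonion.mk c d
      = COctonion.mk (a * c - b * d) (a * d + b * c) := fun _ _ _ _ => rfl
  have ha : ∀ a b c d : Octonion, COctonion.mk a b + COctonion.mk c d
      = COctonion.mk (a + c) (b + d) := fun _ _ _ _ => rfl
  have hs : ∀ (r : ℝ) (a b : Octonion), r • COctonion.mk a b
      = COctonion.mk (r • a) (r • b) := fun _ _ _ => rfl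
  have z1 : ∀ x : Octonion, x * 0 = 0 := fun x => ext' (by simp) (by simp)
  have z2 : ∀ x : Octonion, 0 * x = 0 := fun x => ext' (by simp) (by simp)
  have d1 := fun i => eq_sub_of_add_eq (mul_conj_add (X.2 i) (Y.2 i))
  have d2 := fun i => eq_sub_of_add_eq (conj_mul_add (X.2 i) (Y.2 i))
  ext i j
  fin_cases i <;> fin_cases j <;>
    simp only [toMat, jordan, h1, Matrix.mul_apply, Fin.sum_univ_three, hm, ha, hs, z1, z2,
      Fin.zero_eta, Fin.mk_one, Fin.reduceFinMk, Matrix.smul_apply, Matrix.add_apply,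
      Matrix.of_apply, Matrix.cons_val, add_zero, zero_add, sub_zero, zero_sub, smul_zero,
      smul_one_mul, mul_smul_one, conj_mul, conj_add, conj_sub, conj_smul, conj_conj,
      d1, d2] <;>
    refine congrArg₂ COctonion.mk ?_ ?_ <;> module


/-- The unit element `E`. -/
def E : J1 := h1 1 1 1 0 0 0

/-- The trace. -/
def tr (X : J1) : ℝ := X.1 0 + X.1 1 + X.1 2

/-- The inner product `(X|Y) = tr (X ∘ Y)`. -/
def bil (X Y : J1) : ℝ := tr (jordan X Y)

/-- The cross product `X × Y`. -/
def cross (X Y : J1) : J1 :=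
  (2⁻¹ : ℝ) • ((2 : ℝ) • jordan X Y - tr X • Y - tr Y • X + (tr X * tr Y - bil X Y) • E)

/-- The idempotents `E₁, E₂, E₃`. -/
def E₁ : J1 := h1 1 0 0 0 0 0
def E₂ : J1 := h1 0 1 0 0 0 0
def E₃ : J1 := h1 0 0 1 0 0 0

/-- The element `F₃¹(x)`. -/
def F₃ (x : Octonion) : J1 := h1 0 0 0 0 0 x

/-- The element `P⁻ = h¹(-1, 1, 0; 0, 0, 1)`. -/
def Pminus : J1 := h1 (-1) 1 0 0 0 1

/-- The negative null cone `𝒩₁⁻`. -/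
def negCone : Set J1 := {X | cross X X = 0 ∧ tr X = 0 ∧ bil E₁ X < 0}

/-! ## The group -/

/-- The group `F₄₍₋₂₀₎` of all automorphisms of the exceptional Jordan algebra, with the topology
of a group of matrices. (Linear maps of the finite-dimensional space `J1` are continuous, so that
the group of units of `J1 →L[ℝ] J1` is the general linear group.) -/
def F4 : Subgroup (J1 →L[ℝ] J1)ˣ where
  carrier := {g | ∀ X Y, g.val (jordan X Y) = jordan (g.val X) (g.val Y)}
  mul_mem' := by
    intro a b ha hb X Y
    simp only [Set.mem_ofPred_eq] at ha hb
    simp [ha, hb]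
  one_mem' := by intro X Y; simp
  inv_mem' := by
    intro g hg X Y
    simp only [Set.mem_ofPred_eq] at hg
    have h : ∀ Z, g.val (g⁻¹.val Z) = Z := fun Z => by
      rw [← mul_apply_eq_comp, Units.mul_inv]; rfl
    have h' : ∀ Z, g⁻¹.val (g.val Z) = Z := fun Z => by
      rw [← mul_apply_eq_comp, Units.inv_mul]; rfl
    rw [← h' (jordan (g⁻¹.val X) (g⁻¹.val Y)), hg, h, h]

/-- The linear map of an element of the group. -/
def lin (g : F4) : J1 →L[ℝ] J1 := g.val.val

theorem lin_jordan (g : F4) (X Y : J1) : lin g (jordan X Y) = jordan (lin g X) (lin g Y) :=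
  g.property X Y

theorem lin_one (X : J1) : lin 1 X = X := rfl

theorem lin_mul (g g' : F4) (X : J1) : lin (g * g') X = lin g (lin g' X) := rfl

/-! ## The group acts on the negative null cone -/

open Octonion

theorem h1_congr {a b c a' b' c' : ℝ} {x y z x' y' z' : Octonion} (ha : a = a') (hb : b = b')
    (hc : c = c') (hx : x = x') (hy : y = y') (hz : z = z') :
    h1 a b c x y z = h1 a' b' c' x' y' z' := by
  subst ha hb hc hx hy hz; rfl

theorem jordan_self (X : J1) : jordan X X =
    h1 (X.1 0 ^ 2 - ip (X.2 1) (X.2 1) - ip (X.2 2) (X.2 2))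
      (X.1 1 ^ 2 + ip (X.2 0) (X.2 0) - ip (X.2 2) (X.2 2))
      (X.1 2 ^ 2 + ip (X.2 0) (X.2 0) - ip (X.2 1) (X.2 1))
      ((X.1 1 + X.1 2) • X.2 0 - conj (X.2 1 * X.2 2))
      ((X.1 2 + X.1 0) • X.2 1 + conj (X.2 2 * X.2 0))
      ((X.1 0 + X.1 1) • X.2 2 + conj (X.2 0 * X.2 1)) := by
  unfold jordan
  exact h1_congr (by ring) (by ring) (by ring) (by module) (by module) (by module)

theorem ip_comm (x y : Octonion) : ip x y = ip y x := by
  simp [ip]; ring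

theorem ip_smul_left (r : ℝ) (x y : Octonion) : ip (r • x) y = r * ip x y := by
  simp [ip]; ring

theorem ip_smul_right (r : ℝ) (x y : Octonion) : ip x (r • y) = r * ip x y := by
  simp [ip]; ring

theorem ip_conj (x : Octonion) : ip (conj x) (conj x) = ip x x := by simp [ip]

theorem ip_cycle (x y z : Octonion) : ip x (conj (y * z)) = ip y (conj (z * x)) := by
  simp [ip]; ring

theorem ip_neg_right (x y : Octonion) : ip x (-y) = - ip x y := by
  simp [ip]; ring

theorem ip_zero (x : Octonion) : ip x 0 = 0 := by simp [ip]

theorem ip_cs (x y x' y' : Octonion) :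
    (ip x x' + ip y y') ^ 2 ≤ (ip x x + ip y y) * (ip x' x' + ip y' y') := by
  have h := fun t : ℝ => add_nonneg (ip_self_nonneg (t • x + x')) (ip_self_nonneg (t • y + y'))
  have e : ∀ (t : ℝ) (a b : Octonion),
      ip (t • a + b) (t • a + b) = t ^ 2 * ip a a + 2 * t * ip a b + ip b b := by
    intro t a b; simp [ip]; ring
  have := discrim_le_zero (a := ip x x + ip y y) (b := 2 * (ip x x' + ip y y'))
    (c := ip x' x' + ip y' y') (fun t => by have := h t; rw [e, e] at this; nlinarith)
  rw [discrim] at this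
  nlinarith

theorem h1_eq_zero {a b c : ℝ} {x y z : Octonion} :
    h1 a b c x y z = 0 ↔ a = 0 ∧ b = 0 ∧ c = 0 ∧ x = 0 ∧ y = 0 ∧ z = 0 := by
  simp [h1, Prod.ext_iff, funext_iff, Fin.forall_fin_succ]; tauto

theorem bil_E₁ (X : J1) : bil E₁ X = X.1 0 := by
  simp [bil, tr, jordan, E₁, h1, ip]

theorem eq_zero_of_sq {X : J1} (h : jordan X X = 0) (h0 : X.1 0 = 0) : X = 0 := by
  rw [jordan_self, h1_eq_zero] at h
  obtain ⟨e1, e2, e3, -⟩ := h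
  rw [h0] at e1
  have n0 := ip_self_nonneg (X.2 0)
  have n1 := ip_self_nonneg (X.2 1)
  have n2 := ip_self_nonneg (X.2 2)
  have k1 : ip (X.2 1) (X.2 1) = 0 := by nlinarith
  have k2 : ip (X.2 2) (X.2 2) = 0 := by nlinarith
  have k0 : ip (X.2 0) (X.2 0) = 0 := by nlinarith [sq_nonneg (X.1 1)]
  have q1 : X.1 1 = 0 := by nlinarith
  have q2 : X.1 2 = 0 := by nlinarith
  refine Prod.ext (funext fun i => ?_) (funext fun i => ?_)
  · fin_cases i <;> assumption
  · fin_cases i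
    · exact eq_zero_of_ip_self k0
    · exact eq_zero_of_ip_self k1
    · exact eq_zero_of_ip_self k2

/-- The diagonal of an element of square zero. -/
theorem sq_zero_diag {X : J1} (h : jordan X X = 0) (h0 : X.1 0 ≠ 0) :
    X.1 0 + X.1 1 + X.1 2 = 0 ∧ ip (X.2 1) (X.2 1) = X.1 2 * (X.1 1 + X.1 2) ∧
      ip (X.2 2) (X.2 2) = X.1 1 * (X.1 1 + X.1 2) := by
  rw [jordan_self, h1_eq_zero] at h
  obtain ⟨e1, e2, e3, f1, f2, f3⟩ := h
  have f1' := sub_eq_zero.1 f1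
  have f2' := eq_neg_of_add_eq_zero_left f2
  have f3' := eq_neg_of_add_eq_zero_left f3
  have g1 := congrArg (fun z => ip (X.2 0) z) f1'
  have g2 := congrArg (fun z => ip (X.2 1) z) f2'
  have g3 := congrArg (fun z => ip (X.2 2) z) f3'
  have g4 := congrArg (fun z => ip z z) f1'
  simp only [ip_smul_left, ip_smul_right, ip_neg_right, ip_conj, ip_mul_self] at g1 g2 g3 g4
  rw [ip_cycle (X.2 1)] at g2
  rw [ip_cycle (X.2 0), ip_cycle (X.2 1)] at g1
  generalize ip (X.2 2) (conj (X.2 0 * X.2 1)) = T at *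
  generalize ip (X.2 0) (X.2 0) = a at *
  generalize ip (X.2 1) (X.2 1) = b at *
  generalize ip (X.2 2) (X.2 2) = c at *
  generalize X.1 0 = p at *
  generalize X.1 1 = q at *
  generalize X.1 2 = r at *
  have hb : b = r ^ 2 + a := by linarith
  have hc : c = q ^ 2 + a := by linarith
  subst hb hc
  have ha : a = q * r := by
    have : (q * r - a) ^ 2 = 0 := by linear_combination -g4
    have := pow_eq_zero_iff (two_ne_zero) |>.1 this
    linarith
  subst ha
  refine ⟨?_, by ring, by ring⟩
  have : (p - (q + r)) * (p + (q + r)) = 0 := by linear_combination e1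
  rcases mul_eq_zero.1 this with h | h
  · exfalso
    have hp : p = q + r := by linarith
    subst hp
    have k3 : (q + r) ^ 2 * r = 0 := by linear_combination (g2 + g1) / 2
    have k2 : (q + r) ^ 2 * q = 0 := by linear_combination (g3 + g1) / 2
    have : (q + r) ^ 3 = 0 := by linear_combination k2 + k3
    exact h0 (pow_eq_zero_iff (three_ne_zero) |>.1 this)
  · linarith

theorem mem_negCone_iff {X : J1} : X ∈ negCone ↔ jordan X X = 0 ∧ X.1 0 < 0 := by
  constructor
  · rintro ⟨h1, h2, h3⟩
    rw [bil_E₁] at h3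
    refine ⟨?_, h3⟩
    have t : tr (cross X X) = 0 := by rw [h1]; simp [tr]
    have e : tr (cross X X) = - bil X X / 2 := by
      simp only [cross, h2, bil]; simp [tr, E, ExcF4.h1]; ring
    have hb : bil X X = 0 := by linarith
    simpa [cross, h2, hb] using h1
  · rintro ⟨h1, h2⟩
    have ht : tr X = 0 := (sq_zero_diag h1 h2.ne).1
    have hb : bil X X = 0 := by rw [bil, h1]; simp [tr]
    exact ⟨by simp [cross, h1, ht, hb], ht, by rwa [bil_E₁]⟩

theorem h1_eta (X : J1) : h1 (X.1 0) (X.1 1) (X.1 2) (X.2 0) (X.2 1) (X.2 2) = X := by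
  refine Prod.ext (funext fun i => ?_) (funext fun i => ?_) <;> fin_cases i <;> rfl

theorem smul_h1 (l a b c : ℝ) (x y z : Octonion) :
    l • h1 a b c x y z = h1 (l * a) (l * b) (l * c) (l • x) (l • y) (l • z) := by
  refine Prod.ext (funext fun i => ?_) (funext fun i => ?_) <;> fin_cases i <;> rfl

theorem jordan_h1 (a b c a' b' c' : ℝ) (x y z x' y' z' : Octonion) :
    jordan (h1 a b c x y z) (h1 a' b' c' x' y' z') =
    h1 (a * a' - ip y y' - ip z z') (b * b' + ip x x' - ip z z') (c * c' + ip x x' - ip y y')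
    ((2⁻¹ : ℝ) • ((b + c) • x' + (b' + c') • x - conj (y * z') - conj (y' * z)))
    ((2⁻¹ : ℝ) • ((c + a) • y' + (c' + a') • y + conj (z * x') + conj (z' * x)))
    ((2⁻¹ : ℝ) • ((a + b) • z' + (a' + b') • z + conj (x * y') + conj (x' * y))) := rfl

theorem smul_mul' (r : ℝ) (x y : Octonion) : (r • x) * y = r • (x * y) := by
  refine ext8 ?_ ?_ ?_ ?_ ?_ ?_ ?_ ?_ <;> simp <;> ring

theorem mul_smul' (r : ℝ) (x y : Octonion) : x * (r • y) = r • (x * y) := by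
  refine ext8 ?_ ?_ ?_ ?_ ?_ ?_ ?_ ?_ <;> simp <;> ring

theorem mul_zero' (x : Octonion) : x * 0 = 0 := ext' (by simp) (by simp)

theorem zero_mul' (x : Octonion) : 0 * x = 0 := ext' (by simp) (by simp)

theorem ip_zero_left (x : Octonion) : ip 0 x = 0 := by simp [ip]

theorem conj_mul_self (x : Octonion) : conj x * x = ip x x • 1 := by
  refine ext8 ?_ ?_ ?_ ?_ ?_ ?_ ?_ ?_ <;> simp [ip] <;> ring

theorem mul_conj_self (x : Octonion) : x * conj x = ip x x • 1 := by
  refine ext8 ?_ ?_ ?_ ?_ ?_ ?_ ?_ ?_ <;> simp [ip] <;> ring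

theorem ip_one : ip 1 1 = 1 := by simp [ip]

/-- Elements of the negative null cone have square roots up to a positive factor. -/
theorem exists_sqrt {X : J1} (h : jordan X X = 0) (h0 : X.1 0 < 0) :
    ∃ (W : J1) (l : ℝ), 0 < l ∧ jordan W W = l • X ∧ jordan X W = 0 := by
  obtain ⟨s, hb, hc⟩ := sq_zero_diag h h0.ne
  rw [jordan_self, h1_eq_zero] at h
  obtain ⟨e1, e2, e3, f1, f2, f3⟩ := h
  rw [← h1_eta X]
  have nb := ip_self_nonneg (X.2 1)
  have nc := ip_self_nonneg (X.2 2)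
  generalize X.1 0 = p at *
  generalize X.1 1 = q at *
  generalize X.1 2 = r at *
  generalize X.2 0 = x at *
  generalize X.2 1 = y at *
  generalize X.2 2 = z at *
  obtain rfl : p = -(q + r) := by linarith
  have hp : 0 < q + r := by linarith
  have hr : 0 ≤ r := by rw [hb] at nb; exact nonneg_of_mul_nonneg_left nb hp
  have hq : 0 ≤ q := by rw [hc] at nc; exact nonneg_of_mul_nonneg_left nc hp
  have f1' : conj (y * z) = (q + r) • x := (sub_eq_zero.1 f1).symm
  have f2' : conj (z * x) = q • y := by
    rw [eq_neg_of_add_eq_zero_right f2]; module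
  have f3' : conj (x * y) = r • z := by
    rw [eq_neg_of_add_eq_zero_right f3]; module
  have ha : ip x x = q * r := by linarith
  rcases hq.eq_or_lt with hq0 | hq
  · subst hq0
    have hz : z = 0 := eq_zero_of_ip_self (by rw [hc]; ring)
    subst hz
    have hx : x = 0 := eq_zero_of_ip_self (by rw [ha]; ring)
    subst hx
    refine ⟨h1 0 0 0 (conj y) 0 (r • 1), r, by linarith, ?_, ?_⟩
    · rw [jordan_h1, smul_h1]
      simp only [ip_conj, ip_zero, ip_smul_left, ip_smul_right, ip_one, mul_zero',
        smul_one_mul, mul_smul_one, conj_smul, conj_conj, conj_zero, hb]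
      exact h1_congr (by ring) (by ring) (by ring) (by module) (by module) (by module)
    · rw [jordan_h1, h1_eq_zero]
      simp only [ip_zero, ip_zero_left, mul_zero', zero_mul', mul_smul_one, conj_smul, conj_zero,
        conj_mul_self, hb]
      refine ⟨by ring, by ring, by ring, by module, by module, ?_⟩
      have : conj (1 : Octonion) = 1 := ext' (by simp) (by simp)
      rw [this]; module
  rcases hr.eq_or_lt with hr0 | hr
  · subst hr0
    have hy : y = 0 := eq_zero_of_ip_self (by rw [hb]; ring)
    subst hy
    have hx : x = 0 := eq_zero_of_ip_self (by rw [ha]; ring)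
    subst hx
    refine ⟨h1 0 0 0 (conj z) (q • 1) 0, q, by linarith, ?_, ?_⟩
    · rw [jordan_h1, smul_h1]
      simp only [ip_conj, ip_zero, ip_smul_left, ip_smul_right, ip_one, mul_zero', zero_mul',
        mul_smul_one, conj_smul, conj_conj, conj_zero, hc]
      exact h1_congr (by ring) (by ring) (by ring) (by module) (by module) (by module)
    · rw [jordan_h1, h1_eq_zero]
      simp only [ip_zero, ip_zero_left, mul_zero', zero_mul', smul_one_mul, conj_smul, conj_zero,
        mul_conj_self, hc]
      refine ⟨by ring, by ring, by ring, by module, ?_, by module⟩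
      have : conj (1 : Octonion) = 1 := ext' (by simp) (by simp)
      rw [this]; module
  · refine ⟨h1 0 (-2 * q * r) (2 * q * r) ((q - r) • x) (q • y) (-r • z), q * r * (q + r),
      by positivity, ?_, ?_⟩
    · rw [jordan_h1, smul_h1]
      simp only [ip_smul_left, ip_smul_right, smul_mul', mul_smul', conj_smul, f1', f2', f3',
        ha, hb, hc]
      exact h1_congr (by ring) (by ring) (by ring) (by module) (by module) (by module)
    · rw [jordan_h1, h1_eq_zero]
      simp only [ip_smul_right, smul_mul', mul_smul', conj_smul, f1', f2', f3', ha, hb, hc]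
      refine ⟨by ring, by ring, by ring, by module, by module, by module⟩

theorem neg_of_sqrt {X W : J1} {l : ℝ} (hl : 0 < l) (h : jordan X X = 0)
    (hW : jordan W W = l • X) (hXW : jordan X W = 0) : X.1 0 ≤ 0 := by
  by_contra! h0
  have a1 := congrArg (fun Z : J1 => Z.1 0) h
  have a2 := congrArg (fun Z : J1 => Z.1 0) hW
  have a3 := congrArg (fun Z : J1 => Z.1 0) hXW
  simp [jordan, h1] at a1 a2 a3
  have cs := ip_cs (X.2 1) (X.2 2) (W.2 1) (W.2 2)
  have e1 : ip (X.2 1) (X.2 1) + ip (X.2 2) (X.2 2) = X.1 0 ^ 2 := by linarith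
  have e2 : ip (X.2 1) (W.2 1) + ip (X.2 2) (W.2 2) = X.1 0 * W.1 0 := by linarith
  have e3 : ip (W.2 1) (W.2 1) + ip (W.2 2) (W.2 2) = W.1 0 ^ 2 - l * X.1 0 := by linarith
  rw [e1, e2, e3] at cs
  have : 0 < X.1 0 ^ 2 * (l * X.1 0) := by positivity
  nlinarith

theorem negCone_invariant (g : F4) {X : J1} (hX : X ∈ negCone) : lin g X ∈ negCone := by
  obtain ⟨h, h0⟩ := mem_negCone_iff.1 hX
  obtain ⟨W, l, hl, hW, hXW⟩ := exists_sqrt h h0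
  have k : jordan (lin g X) (lin g X) = 0 := by rw [← lin_jordan, h, map_zero]
  refine mem_negCone_iff.2 ⟨k, lt_of_le_of_ne ?_ fun hz => ?_⟩
  · exact neg_of_sqrt (W := lin g W) hl k (by rw [← lin_jordan, hW, map_smul])
      (by rw [← lin_jordan, hXW, map_zero])
  · have hgX := eq_zero_of_sq k hz
    have : X = 0 := by
      rw [← lin_one X, ← inv_mul_cancel g, lin_mul, hgX, map_zero]
    rw [this] at h0
    exact lt_irrefl _ h0

/-- `X ∼ Y` if and only if `Y = r X` for some `r > 0`. -/
def raySetoid : Setoid negCone where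
  r X Y := ∃ r : ℝ, 0 < r ∧ Y.val = r • X.val
  iseqv :=
    { refl := fun X => ⟨1, one_pos, (one_smul ℝ X.val).symm⟩
      symm := by
        rintro X Y ⟨r, hr, h⟩
        exact ⟨r⁻¹, inv_pos.2 hr, by rw [h, inv_smul_smul₀ hr.ne']⟩
      trans := by
        rintro X Y Z ⟨r, hr, h⟩ ⟨t, ht, h'⟩
        exact ⟨t * r, mul_pos ht hr, by rw [h', h, mul_smul]⟩ }

/-- `ℱ = 𝒩₁⁻ / ∼`, with the quotient topology. -/
def Furst : Type := Quotient raySetoid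

instance : TopologicalSpace Furst := inferInstanceAs (TopologicalSpace (Quotient raySetoid))

/-- The class `[X]` of `X`. -/
def cls (X : negCone) : Furst := Quotient.mk raySetoid X

/-- The action `g [X] = [g X]`. -/
instance : MulAction F4 Furst where
  smul g := Quotient.map (fun X : negCone => (⟨lin g X.val, negCone_invariant g X.property⟩ : negCone))
    (by rintro X Y ⟨r, hr, h⟩; exact ⟨r, hr, by simp only [h, map_smul]⟩)
  one_smul := by rintro ⟨X⟩; rfl
  mul_smul := by rintro g g' ⟨X⟩; rfl

theorem smul_cls (g : F4) (X : negCone) :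
    g • cls X = cls ⟨lin g X.val, negCone_invariant g X.property⟩ := rfl

theorem Pminus_mem : Pminus ∈ negCone := by
  rw [mem_negCone_iff, jordan_self, h1_eq_zero]
  simp [Pminus, h1, ip, mul_zero', zero_mul', conj_zero]

/-- The point `[P⁻]`. -/
def ptP : Furst := cls ⟨Pminus, Pminus_mem⟩

/-! ## The subgroups -/

/-- The linear map `σ : h¹(ξ₁, ξ₂, ξ₃; x₁, x₂, x₃) ↦ h¹(ξ₁, ξ₂, ξ₃; x₁, -x₂, -x₃)`. -/
def sigmaLin : J1 →ₗ[ℝ] J1 where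
  toFun X := h1 (X.1 0) (X.1 1) (X.1 2) (X.2 0) (-X.2 1) (-X.2 2)
  map_add' X Y := by
    refine Prod.ext (funext fun i => ?_) (funext fun i => ?_) <;> fin_cases i <;> simp [h1] <;> abel
  map_smul' r X := by
    refine Prod.ext (funext fun i => ?_) (funext fun i => ?_) <;> fin_cases i <;> simp [h1]

theorem sigmaLin_sigmaLin (X : J1) : sigmaLin (sigmaLin X) = X := by
  refine Prod.ext (funext fun i => ?_) (funext fun i => ?_) <;> fin_cases i <;> simp [sigmaLin, h1]

/-- The element `σ` of the group. -/
def sigma : F4 :=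
  ⟨⟨sigmaLin.toContinuousLinearMap, sigmaLin.toContinuousLinearMap,
      ContinuousLinearMap.ext sigmaLin_sigmaLin, ContinuousLinearMap.ext sigmaLin_sigmaLin⟩, by
    intro X Y
    have n1 : ∀ x y : Octonion, (-x) * y = -(x * y) := fun x y => by
      simpa using smul_mul' (-1) x y
    have n2 : ∀ x y : Octonion, x * (-y) = -(x * y) := fun x y => by
      simpa using mul_smul' (-1) x y
    have n3 : ∀ x : Octonion, conj (-x) = -conj x := fun x => by
      simpa using conj_smul (-1) x
    have n4 : ∀ x y : Octonion, ip (-x) y = -ip x y := fun x y => by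
      simpa using ip_smul_left (-1) x y
    change sigmaLin (jordan X Y) = jordan (sigmaLin X) (sigmaLin Y)
    rw [← h1_eta X, ← h1_eta Y]
    simp only [sigmaLin, LinearMap.coe_mk, AddHom.coe_mk, jordan_h1]
    simp only [h1, Matrix.cons_val, n1, n2, n3, n4, ip_neg_right, neg_neg]
    refine Prod.ext (funext fun i => ?_) (funext fun i => ?_) <;> fin_cases i <;>
      simp only [Fin.zero_eta, Fin.mk_one, Fin.reduceFinMk, Matrix.cons_val] <;> module⟩

/-- `K`, the fixed points of the involution `g ↦ σ g σ⁻¹`. -/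
def K : Subgroup F4 where
  carrier := {g | sigma * g * sigma⁻¹ = g}
  mul_mem' := by
    intro a b ha hb
    simp only [Set.mem_ofPred_eq] at ha hb ⊢
    calc sigma * (a * b) * sigma⁻¹ = (sigma * a * sigma⁻¹) * (sigma * b * sigma⁻¹) := by group
      _ = a * b := by rw [ha, hb]
  one_mem' := by simp
  inv_mem' := by
    intro a ha
    simp only [Set.mem_ofPred_eq] at ha ⊢
    nth_rewrite 2 [← ha]; group

/-- The stabilizer of an element of the Jordan algebra. -/
def stab (X : J1) : Subgroup F4 where
  carrier := {g | lin g X = X}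
  mul_mem' := by
    intro a b ha hb
    simp only [Set.mem_ofPred_eq] at ha hb ⊢
    rw [lin_mul, hb, ha]
  one_mem' := lin_one X
  inv_mem' := by
    intro a ha
    simp only [Set.mem_ofPred_eq] at ha ⊢
    nth_rewrite 1 [← ha]
    rw [← lin_mul, inv_mul_cancel, lin_one]

/-- `Spin(9)`, realized as the stabilizer of `E₁`. -/
def Spin9 : Subgroup F4 := stab E₁

/-- `Spin(7)`, realized as the pointwise stabilizer of `E₁, E₂, E₃, F₃¹(1)`. -/
def Spin7 : Subgroup F4 := stab E₁ ⊓ stab E₂ ⊓ stab E₃ ⊓ stab (F₃ 1)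

theorem ip_add_left (x y z : Octonion) : ip (x + y) z = ip x z + ip y z := by
  simp [ip]; ring

theorem add_mul' (x y z : Octonion) : (x + y) * z = x * z + y * z := by
  refine ext8 ?_ ?_ ?_ ?_ ?_ ?_ ?_ ?_ <;> simp <;> ring

theorem mul_add' (x y z : Octonion) : z * (x + y) = z * x + z * y := by
  refine ext8 ?_ ?_ ?_ ?_ ?_ ?_ ?_ ?_ <;> simp <;> ring

theorem jordan_comm (X Y : J1) : jordan X Y = jordan Y X := by
  unfold jordan
  rw [ip_comm (X.2 0), ip_comm (X.2 1), ip_comm (X.2 2)]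
  exact h1_congr (by ring) (by ring) (by ring) (by module) (by module) (by module)

theorem h1_add (a b c a' b' c' : ℝ) (x y z x' y' z' : Octonion) :
    h1 a b c x y z + h1 a' b' c' x' y' z' =
      h1 (a + a') (b + b') (c + c') (x + x') (y + y') (z + z') := by
  refine Prod.ext (funext fun i => ?_) (funext fun i => ?_) <;> fin_cases i <;> rfl

theorem jordan_add_left (X Y Z : J1) : jordan (X + Y) Z = jordan X Z + jordan Y Z := by
  unfold jordan
  simp only [h1_add, Prod.fst_add, Prod.snd_add, Pi.add_apply, ip_add_left, add_mul', mul_add',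
    conj_add]
  exact h1_congr (by ring) (by ring) (by ring) (by module) (by module) (by module)

theorem jordan_smul_left (r : ℝ) (X Z : J1) : jordan (r • X) Z = r • jordan X Z := by
  unfold jordan
  simp only [smul_h1, Prod.smul_fst, Prod.smul_snd, Pi.smul_apply, ip_smul_left, smul_mul',
    mul_smul', conj_smul, smul_eq_mul]
  exact h1_congr (by ring) (by ring) (by ring) (by module) (by module) (by module)

theorem jordan_add_right (X Y Z : J1) : jordan Z (X + Y) = jordan Z X + jordan Z Y := by
  rw [jordan_comm, jordan_add_left, jordan_comm X, jordan_comm Y]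

theorem jordan_smul_right (r : ℝ) (X Z : J1) : jordan Z (r • X) = r • jordan Z X := by
  rw [jordan_comm, jordan_smul_left, jordan_comm X]

/-- The Lie algebra `𝔣₄₍₋₂₀₎`: the derivations of the Jordan algebra. -/
def f4 : Submodule ℝ (J1 →L[ℝ] J1) where
  carrier := {D | ∀ X Y, D (jordan X Y) = jordan (D X) Y + jordan X (D Y)}
  add_mem' := by
    intro a b ha hb X Y
    simp only [Set.mem_ofPred_eq] at ha hb
    simp only [add_apply, ha, hb, jordan_add_left, jordan_add_right]
    abel
  zero_mem' := by
    intro X Y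
    have h := jordan_smul_left 0 0 Y
    have h' := jordan_smul_right 0 0 X
    rw [zero_smul, zero_smul] at h h'
    simp [h, h']
  smul_mem' := by
    intro r a ha X Y
    simp only [Set.mem_ofPred_eq] at ha
    simp only [smul_apply, ha, jordan_smul_left, jordan_smul_right, smul_add]

/-- The derivation `Ã₃¹(1)`, as a linear map. -/
def A3Lin : J1 →ₗ[ℝ] J1 where
  toFun X := h1 (-2 * ip 1 (X.2 2)) (2 * ip 1 (X.2 2)) 0
    (conj (X.2 1)) (conj (X.2 0)) ((X.1 1 - X.1 0) • 1)
  map_add' X Y := by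
    have e : ∀ x y z : Octonion, ip z (x + y) = ip z x + ip z y := fun x y z => by
      rw [ip_comm, ip_add_left, ip_comm x, ip_comm y]
    simp only [h1_add, Prod.fst_add, Prod.snd_add, Pi.add_apply, e, conj_add]
    exact h1_congr (by ring) (by ring) (by ring) (by module) (by module) (by module)
  map_smul' r X := by
    simp only [smul_h1, Prod.smul_fst, Prod.smul_snd, Pi.smul_apply, ip_smul_right, conj_smul,
      smul_eq_mul, RingHom.id_apply]
    exact h1_congr (by ring) (by ring) (by ring) (by module) (by module) (by module)

/-- The derivation `Ã₃¹(1)`. -/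
def A3 : J1 →L[ℝ] J1 := A3Lin.toContinuousLinearMap

theorem conj_eq (x : Octonion) : conj x = (2 * ip 1 x) • 1 - x := by
  refine ext8 ?_ ?_ ?_ ?_ ?_ ?_ ?_ ?_ <;> simp [ip]; ring

theorem sub_mul' (x y z : Octonion) : (x - y) * z = x * z - y * z :=
  ext' (by simp; noncomm_ring) (by simp; noncomm_ring)

theorem mul_sub' (x y z : Octonion) : z * (x - y) = z * x - z * y :=
  ext' (by simp; noncomm_ring) (by simp; noncomm_ring)

theorem A3_mem : A3 ∈ f4 := by
  intro X Y
  change A3Lin (jordan X Y) = jordan (A3Lin X) Y + jordan X (A3Lin Y)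
  have d1 := eq_sub_of_add_eq (mul_conj_add (X.2 0) (Y.2 0))
  have d2 := eq_sub_of_add_eq (conj_mul_add (X.2 1) (Y.2 1))
  rw [← h1_eta X, ← h1_eta Y]
  simp only [A3Lin, LinearMap.coe_mk, AddHom.coe_mk, jordan_h1]
  simp only [h1, Matrix.cons_val]
  refine Prod.ext (funext fun i => ?_) (funext fun i => ?_) <;> fin_cases i <;>
    simp only [Fin.zero_eta, Fin.mk_one, Fin.reduceFinMk, Matrix.cons_val, Prod.fst_add,
      Prod.snd_add, Pi.add_apply]
  · simp [ip]; ring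
  · simp [ip]; ring
  · simp [ip]
  · simp only [conj_add, Octonion.conj_mul, conj_smul, conj_conj, Octonion.smul_one_mul, Octonion.mul_smul_one,
      conj_eq (X.2 2), conj_eq (Y.2 2), conj_sub, sub_mul', mul_sub']
    module
  · simp only [conj_add, Octonion.conj_mul, conj_smul, conj_conj, Octonion.smul_one_mul, Octonion.mul_smul_one,
      conj_eq (X.2 2), conj_eq (Y.2 2), conj_sub, sub_mul', mul_sub']
    module
  · have c1 : conj (1 : Octonion) = 1 := ext' (by simp) (by simp)
    simp only [Octonion.conj_mul, conj_conj, conj_sub, conj_smul, c1, d1, d2]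
    module

/-- The root space `{D ∈ 𝔣₄₍₋₂₀₎ | [Ã₃¹(1), D] = c D}`, which is `𝔤_{cα}` for `c ≠ 0`. -/
def rootSpace (c : ℝ) : Submodule ℝ (J1 →L[ℝ] J1) where
  carrier := {D | D ∈ f4 ∧ A3 * D - D * A3 = c • D}
  add_mem' := by
    rintro a b ⟨ha, ha'⟩ ⟨hb, hb'⟩
    refine ⟨add_mem ha hb, ?_⟩
    rw [smul_add, ← ha', ← hb']; noncomm_ring
  zero_mem' := ⟨zero_mem _, by simp⟩
  smul_mem' := by
    rintro r a ⟨ha, ha'⟩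
    refine ⟨Submodule.smul_mem _ _ ha, ?_⟩
    rw [smul_comm, ← ha', mul_smul_comm, smul_mul_assoc, smul_sub]

/-- `𝔫⁺ = 𝔤_α ⊕ 𝔤_{2α}`. -/
def nPlus : Submodule ℝ (J1 →L[ℝ] J1) := rootSpace 1 ⊔ rootSpace 2

/-- `A = {exp (t Ã₃¹(1)) | t ∈ ℝ}`. -/
def A : Set F4 := {g | ∃ t : ℝ, lin g = NormedSpace.exp (t • A3)}

/-- `N⁺ = exp 𝔫⁺`. -/
def Nplus : Set F4 := {g | ∃ D ∈ nPlus, lin g = NormedSpace.exp D}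

/-- `M`, the centralizer of `Ã₃¹(1)` in `K`. -/
def M : Set F4 := {k | k ∈ K ∧ lin k * A3 * lin k⁻¹ = A3}

end ExcF4

end

open scoped Quaternion Pointwise

noncomputable section

namespace ExcF4

open Octonion

/-! ## Linear maps of the Jordan algebra -/

/-! The boundary is a 15-sphere: once the first coordinate of a cone element is scaled to `-1`, the
element is determined by its last two octonions `y`, `z`, subject to `|y|² + |z|² = 1`
(`negCone_ext`, `exists_eq_smul_conePt`). On it `A` fixes `[P⁻]` and the opposite point `[Pminus']`,
spanned by eigenvectors of `A3` for the extreme eigenvalues `2` and `-2`.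

Stabilizer of `[P⁻]`. Elements of `𝔤_{cα}` raise eigenvalues of `A3` by `c`, and none exceeds `2`,
so `N⁺` fixes `P⁻`; `A` scales it, and `M` preserves its eigenline. Conversely, explicit root
vectors show that `N⁺` carries `[Pminus']` to every point other than `[P⁻]` (`exists_exp_Pminus'`).
If `g` fixes `[P⁻]`, some `n ∈ N⁺` takes `[Pminus']` to `g⁻¹[Pminus']`, so `g n` fixes both points,
and a factor from `A` makes it fix the vector `P⁻`. As `P⁻ ∘ Pminus'` is twice an idempotent, the
vector `Pminus'` is then fixed too. These two vectors and the unit determine `E₁, E₂, E₃, F₃ 1`, so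
the remaining factor lies in `Spin7 ⊆ M` (`mem_MAN_of_smul_eq`). Being a stabilizer, `M A N⁺` is a
subgroup.

Orbits and topology. Peirce reflections lie in `Spin9`, and products of them move `P⁻` onto a given
ray continuously in a local parameter (`exists_local_section`). This gives transitivity of `Spin9`,
hence of the larger group `K`, and openness of the orbit maps of `F4` and `Spin9`, which turns the
orbit bijections into homeomorphisms. The stabilizer in `Spin9` is `Spin7`, because `Spin9`
preserves the first coordinate and commutes with `σ`, which exchanges `P⁻` and `Pminus'`. -/

theorem jordan_add_self (X Y : J1) :
    jordan (X + Y) (X + Y) = jordan X X + (2 : ℝ) • jordan X Y + jordan Y Y := by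
  rw [jordan_add_left, jordan_add_right, jordan_add_right, jordan_comm Y X]
  module

/-- A linear map which respects squares respects the Jordan product. -/
theorem map_jordan_of_sq (g : J1 →ₗ[ℝ] J1) (h : ∀ X, g (jordan X X) = jordan (g X) (g X))
    (X Y : J1) : g (jordan X Y) = jordan (g X) (g Y) := by
  have h1 := h (X + Y)
  rw [jordan_add_self, map_add, map_add, map_add, jordan_add_self, h, h, map_smul] at h1
  have h2 := add_left_cancel (add_right_cancel h1)
  exact smul_right_injective J1 (two_ne_zero (α := ℝ)) h2

/-- A linear map which satisfies the Leibniz rule on squares is a derivation. -/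
theorem leibniz_of_sq (D : J1 →ₗ[ℝ] J1) (h : ∀ X, D (jordan X X) = (2 : ℝ) • jordan (D X) X)
    (X Y : J1) : D (jordan X Y) = jordan (D X) Y + jordan X (D Y) := by
  have h1 := h (X + Y)
  rw [jordan_add_self, map_add, map_add, map_add, h, h, map_smul, jordan_add_left,
    jordan_add_right, jordan_add_right] at h1
  have h2 : (2 : ℝ) • D (jordan X Y) = (2 : ℝ) • (jordan (D X) Y + jordan X (D Y)) := by
    rw [jordan_comm X (D Y)]
    linear_combination (norm := module) h1
  exact smul_right_injective J1 (two_ne_zero (α := ℝ)) h2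

/-! ### Composition, alternative and Moufang identities of the octonions -/

theorem ip_add_right (x y z : Octonion) : ip z (x + y) = ip z x + ip z y := by
  simp [ip]; ring

theorem ip_sub_right (x y z : Octonion) : ip z (x - y) = ip z x - ip z y := by
  simp [ip]; ring

theorem ip_sub_left (x y z : Octonion) : ip (x - y) z = ip x z - ip y z := by
  simp [ip]; ring

theorem conj_one : conj (1 : Octonion) = 1 := ext' (by simp) (by simp)

theorem one_mul' (x : Octonion) : 1 * x = x := by simpa using smul_one_mul 1 x

theorem mul_one' (x : Octonion) : x * 1 = x := by simpa using mul_smul_one 1 x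

theorem neg_mul' (x y : Octonion) : (-x) * y = -(x * y) := by simpa using smul_mul' (-1) x y

theorem mul_neg' (x y : Octonion) : x * (-y) = -(x * y) := by simpa using mul_smul' (-1) x y

theorem conj_neg (x : Octonion) : conj (-x) = -conj x := by simpa using conj_smul (-1) x

theorem mul_conj_mul (x y : Octonion) : x * (conj x * y) = ip x x • y := by
  refine ext8 ?_ ?_ ?_ ?_ ?_ ?_ ?_ ?_ <;> simp [ip] <;> ring

theorem conj_mul_mul_self (x y : Octonion) : conj x * (x * y) = ip x x • y := by
  refine ext8 ?_ ?_ ?_ ?_ ?_ ?_ ?_ ?_ <;> simp [ip] <;> ring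

theorem mul_mul_conj (x y : Octonion) : x * y * conj y = ip y y • x := by
  refine ext8 ?_ ?_ ?_ ?_ ?_ ?_ ?_ ?_ <;> simp [ip] <;> ring

theorem mul_conj_mul_self (x y : Octonion) : x * conj y * y = ip y y • x := by
  refine ext8 ?_ ?_ ?_ ?_ ?_ ?_ ?_ ?_ <;> simp [ip] <;> ring

theorem ip_add_self (x y : Octonion) : ip (x + y) (x + y) = ip x x + 2 * ip x y + ip y y := by
  rw [ip_add_left, ip_add_right, ip_add_right, ip_comm y x]; ring

theorem conj_mul_mul_add (x y z : Octonion) :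
    conj x * (y * z) + conj y * (x * z) = (2 * ip x y) • z := by
  have h := conj_mul_mul_self (x + y) z
  rw [conj_add, add_mul', add_mul', mul_add', mul_add', ip_add_self, conj_mul_mul_self,
    conj_mul_mul_self] at h
  linear_combination (norm := module) h

theorem mul_mul_conj_add (x y z : Octonion) :
    z * x * conj y + z * y * conj x = (2 * ip x y) • z := by
  have h := mul_mul_conj z (x + y)
  rw [conj_add, mul_add', mul_add', add_mul', add_mul', ip_add_self, mul_mul_conj,
    mul_mul_conj] at h
  linear_combination (norm := module) h

theorem ip_conj_conj (x y : Octonion) : ip (conj x) (conj y) = ip x y := by simp [ip]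

set_option maxHeartbeats 2000000 in
/-- A consequence of the middle Moufang identity `(x y) (z x) = x (y z) x`. -/
theorem conj_mul_conj_moufang (x y z : Octonion) :
    conj (z * x) * conj (x * y) = (2 * ip x (conj (y * z))) • conj x - ip x x • (y * z) := by
  refine ext8 ?_ ?_ ?_ ?_ ?_ ?_ ?_ ?_ <;> simp [ip] <;> ring

theorem J1_ext {X Y : J1} (a : X.1 0 = Y.1 0) (b : X.1 1 = Y.1 1) (c : X.1 2 = Y.1 2)
    (x : X.2 0 = Y.2 0) (y : X.2 1 = Y.2 1) (z : X.2 2 = Y.2 2) : X = Y := by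
  rw [← h1_eta X, ← h1_eta Y, a, b, c, x, y, z]

/-! ## Peirce reflections -/

/-- The Peirce reflection of the idempotent `½ h¹(0, 1 + c, 1 - c; x, 0, 0)`, where
`c ^ 2 + (x|x) = 1`. -/
def reflLin (c : ℝ) (x : Octonion) : J1 →ₗ[ℝ] J1 where
  toFun X := h1 (X.1 0) (X.1 2 + c * (c * (X.1 1 - X.1 2) + 2 * ip x (X.2 0)))
    (X.1 1 - c * (c * (X.1 1 - X.1 2) + 2 * ip x (X.2 0)))
    ((c * (X.1 1 - X.1 2) + 2 * ip x (X.2 0)) • x - X.2 0)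
    (conj (X.2 2 * x) - c • X.2 1) (c • X.2 2 + conj (x * X.2 1))
  map_add' X Y := by
    simp only [h1_add, Prod.fst_add, Prod.snd_add, Pi.add_apply, ip_add_right, add_mul', mul_add',
      conj_add]
    exact h1_congr (by ring) (by ring) (by ring) (by module) (by module) (by module)
  map_smul' r X := by
    simp only [smul_h1, Prod.smul_fst, Prod.smul_snd, Pi.smul_apply, ip_smul_right, smul_mul',
      mul_smul', conj_smul, smul_eq_mul, RingHom.id_apply]
    exact h1_congr (by ring) (by ring) (by ring) (by module) (by module) (by module)

theorem reflLin_h1 (l : ℝ) (v : Octonion) (a b c : ℝ) (x y z : Octonion) :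
    reflLin l v (h1 a b c x y z) = h1 a (c + l * (l * (b - c) + 2 * ip v x))
    (b - l * (l * (b - c) + 2 * ip v x)) ((l * (b - c) + 2 * ip v x) • v - x)
    (conj (z * v) - l • y) (l • z + conj (v * y)) := rfl

theorem reflLin_reflLin {l : ℝ} {v : Octonion} (h : l ^ 2 + ip v v = 1) (X : J1) :
    reflLin l v (reflLin l v X) = X := by
  have hv : ip v v = 1 - l ^ 2 := by linarith
  rw [← h1_eta X]
  simp only [reflLin_h1, ip_sub_right, ip_smul_right, add_mul', mul_sub',
    smul_mul', mul_smul', conj_add, conj_sub, conj_smul, conj_mul, conj_conj, mul_conj_mul,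
    mul_conj_mul_self, hv]
  exact h1_congr (by ring) (by ring) (by ring) (by module) (by module) (by module)

/-- Entry by entry, the diagonal needs only the cyclic trilinear form, the first octonion the
Moufang identity, and the other two the polarized alternative laws. -/
theorem reflLin_jordan_self {l : ℝ} {v : Octonion} (h : l ^ 2 + ip v v = 1) (X : J1) :
    reflLin l v (jordan X X) = jordan (reflLin l v X) (reflLin l v X) := by
  have hv : ip v v = 1 - l ^ 2 := by linarith
  rw [← h1_eta X]
  generalize X.1 0 = a
  generalize X.1 1 = b
  generalize X.1 2 = c
  generalize X.2 0 = x
  generalize X.2 1 = y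
  generalize X.2 2 = z
  -- All mixed inner products of `v`, `y`, `z` are the same value of the cyclic form `(v | conj (y
  -- z))`.
  have k1 : ip y (conj (z * v)) = ip v (conj (y * z)) := (ip_cycle v y z).symm
  have k2 : ip z (conj (v * y)) = ip v (conj (y * z)) := by rw [← ip_cycle, k1]
  have k1' : ip (conj (z * v)) y = ip v (conj (y * z)) := by rw [ip_comm, k1]
  have k2' : ip (conj (v * y)) z = ip v (conj (y * z)) := by rw [ip_comm, k2]
  simp only [reflLin_h1, jordan_self]
  simp only [h1, Matrix.cons_val]
  change reflLin l v (h1 _ _ _ _ _ _) = h1 _ _ _ _ _ _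
  rw [reflLin_h1]
  have e : (conj (z * v) - l • y) * (l • z + conj (v * y)) =
      (l * ip z z - l * ip y y + 2 * ip v (conj (y * z))) • conj v - y * z := by
    have g1 : conj (z * v) * z = ip z z • conj v := by rw [Octonion.conj_mul, mul_conj_mul_self]
    have g2 : y * conj (v * y) = ip y y • conj v := by rw [Octonion.conj_mul, mul_conj_mul]
    rw [sub_mul', mul_add', mul_add', conj_mul_conj_moufang, mul_smul', smul_mul', smul_mul',
      mul_smul', g1, g2, hv]
    module
  have e2 : (l • z + conj (v * y)) * ((l * (b - c) + 2 * ip v x) • v - x) =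
      (l * (l * (b - c) + 2 * ip v x)) • (z * v) - l • (z * x)
       + (l * (b - c) + 2 * ip v x) • (conj (v * y) * v) - conj (v * y) * x := by
    rw [add_mul', mul_sub', mul_sub', smul_mul', mul_smul', smul_mul', mul_smul']
    module
  have e3 : ((l * (b - c) + 2 * ip v x) • v - x) * (conj (z * v) - l • y) =
      (l * (b - c) + 2 * ip v x) • (v * conj (z * v)) - (l * (l * (b - c) + 2 * ip v x)) • (v * y)
       - x * conj (z * v) + l • (x * y) := by
    rw [sub_mul', mul_sub', mul_sub', smul_mul', mul_smul', smul_mul', mul_smul']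
    module
  -- Associativity fails for `v`, `x`, `y` separately; only the sum symmetric in `v` and `x`
  -- simplifies.
  have f1 : conj (conj (v * y) * x) + conj (conj (x * y) * v) = (2 * ip v x) • y := by
    rw [Octonion.conj_mul _ x, Octonion.conj_mul _ v, conj_conj, conj_conj, conj_mul_mul_add,
      ip_comm]
  have f2 : conj (x * conj (z * v)) + conj (v * conj (z * x)) = (2 * ip v x) • z := by
    rw [Octonion.conj_mul x, Octonion.conj_mul v, conj_conj, conj_conj, mul_mul_conj_add, ip_comm]
  have f3 : conj (conj (v * y) * v) = (1 - l ^ 2) • y := by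
    rw [Octonion.conj_mul, conj_conj, conj_mul_mul_self, hv]
  have f4 : conj (v * conj (z * v)) = (1 - l ^ 2) • z := by
    rw [Octonion.conj_mul, conj_conj, mul_mul_conj, hv]
  rw [e, e2, e3]
  simp only [ip_add_right, ip_add_left, ip_sub_left, ip_sub_right, ip_smul_left, ip_smul_right,
    ip_conj, ip_mul_self, mul_add', add_mul', smul_mul', mul_smul',
    conj_add, conj_sub, conj_smul, hv, k1, k2, k1', k2', conj_conj, f3, f4, ip_comm x v]
  refine h1_congr ?_ ?_ ?_ ?_ ?_ ?_
  · ring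
  · ring
  · ring
  · module
  · linear_combination (norm := module) f1
  · linear_combination (norm := module) f2

/-- The Peirce reflection as an element of the group. -/
def refl (l : ℝ) (v : Octonion) (h : l ^ 2 + ip v v = 1) : F4 :=
  ⟨⟨(reflLin l v).toContinuousLinearMap, (reflLin l v).toContinuousLinearMap,
      ContinuousLinearMap.ext (reflLin_reflLin h), ContinuousLinearMap.ext (reflLin_reflLin h)⟩,
    map_jordan_of_sq (reflLin l v) (reflLin_jordan_self h)⟩

theorem refl_mem_Spin9 (l : ℝ) (v : Octonion) (h : l ^ 2 + ip v v = 1) :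
    refl l v h ∈ Spin9 := by
  change reflLin l v E₁ = E₁
  rw [E₁, reflLin_h1]
  simp only [ip_zero, zero_mul', mul_zero', conj_zero]
  exact h1_congr (by ring) (by ring) (by ring) (by module) (by module) (by module)

/-! ## Root vectors -/

theorem conj_eq_neg {p : Octonion} (hp : ip 1 p = 0) : conj p = -p := by
  rw [conj_eq, hp]; module

/-- The polarized law `conj_mul_mul_add` with `conj p = -p`: it moves an imaginary factor past
another one at the cost of a scalar term. -/
theorem imag_mul_mul {p : Octonion} (hp : ip 1 p = 0) (c w : Octonion) :
    p * (c * w) = conj c * (p * w) - (2 * ip p c) • w := by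
  have h := conj_mul_mul_add p c w
  rw [conj_eq_neg hp, neg_mul'] at h
  linear_combination (norm := module) -h

theorem mul_mul_imag {p : Octonion} (hp : ip 1 p = 0) (c w : Octonion) :
    w * c * p = w * p * conj c - (2 * ip p c) • w := by
  have h := mul_mul_conj_add p c w
  rw [conj_eq_neg hp, mul_neg'] at h
  linear_combination (norm := module) -h

theorem imag_mul_conj_mul {p : Octonion} (hp : ip 1 p = 0) (c w : Octonion) :
    p * (conj c * w) = (2 * ip 1 c) • (p * w) - conj c * (p * w) + (2 * ip p c) • w := by
  have h := imag_mul_mul hp c w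
  nth_rewrite 1 [conj_eq c]
  rw [sub_mul', mul_sub', smul_one_mul, mul_smul', h]
  module

theorem mul_conj_mul_imag {p : Octonion} (hp : ip 1 p = 0) (c w : Octonion) :
    w * conj c * p = (2 * ip 1 c) • (w * p) - w * p * conj c + (2 * ip p c) • w := by
  have h := mul_mul_imag hp c w
  nth_rewrite 1 [conj_eq c]
  rw [mul_sub', sub_mul', mul_smul_one, smul_mul', h]
  module

-- With `u = conj (a * b)`, the two bracketings differ from `u p + p u` by associators of `b̄`, `ā`,
-- `p` in cyclically permuted order, which cancel; the anticommutator of `u` with an imaginary `p`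
-- is the right-hand side. This settles the third octonion entry in `rootLin₂_jordan_self`.
set_option maxHeartbeats 2000000 in
theorem conj_mul_conj_mul_imag {p : Octonion} (hp : ip 1 p = 0) (a b : Octonion) :
    conj b * (conj a * p) + p * conj b * conj a =
      (2 * ip 1 (a * b)) • p - (2 * ip p (conj (a * b))) • 1 := by
  have h : p.1.re = 0 := by simpa [ip] using hp
  refine ext8 ?_ ?_ ?_ ?_ ?_ ?_ ?_ ?_ <;> simp [ip, h] <;> ring

/-- The root vector of weight one with parameter `x`, up to a factor the commutator of the
multiplications by `P⁻` and `h¹(0, 0, 0; x, -x̄, 0)`. -/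
def rootLin₁ (x : Octonion) : J1 →ₗ[ℝ] J1 where
  toFun X := h1 (-2 * ip (conj x) (X.2 1)) (2 * ip x (X.2 0))
    (2 * ip (conj x) (X.2 1) - 2 * ip x (X.2 0))
    ((X.1 2 - X.1 1) • x + conj (X.2 2) * x)
    ((X.1 2 - X.1 0) • conj x - conj x * conj (X.2 2))
    (x * conj (X.2 0) + conj (X.2 1) * conj x)
  map_add' X Y := by
    simp only [h1_add, Prod.fst_add, Prod.snd_add, Pi.add_apply, ip_add_right, add_mul', mul_add',
      conj_add]
    exact h1_congr (by ring) (by ring) (by ring) (by module) (by module) (by module)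
  map_smul' r X := by
    simp only [smul_h1, Prod.smul_fst, Prod.smul_snd, Pi.smul_apply, ip_smul_right, smul_mul',
      mul_smul', conj_smul, smul_eq_mul, RingHom.id_apply]
    exact h1_congr (by ring) (by ring) (by ring) (by module) (by module) (by module)

theorem rootLin₁_h1 (v : Octonion) (a b c : ℝ) (x y z : Octonion) :
    rootLin₁ v (h1 a b c x y z) = h1 (-2 * ip (conj v) y) (2 * ip v x)
    (2 * ip (conj v) y - 2 * ip v x) ((c - b) • v + conj z * v)
    ((c - a) • conj v - conj v * conj z) (v * conj x + conj y * conj v) := rfl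

/-- The root vector of weight two with parameter `p`, up to a factor the commutator of the
multiplications by `P⁻` and `F₃¹(p)`, for imaginary `p`. -/
def rootLin₂ (p : Octonion) : J1 →ₗ[ℝ] J1 where
  toFun X := h1 (-2 * ip p (X.2 2)) (2 * ip p (X.2 2)) 0
    (p * (X.2 0 - conj (X.2 1))) ((X.2 1 - conj (X.2 0)) * p)
    ((X.1 1 - X.1 0 - 2 * ip 1 (X.2 2)) • p + (2 * ip p (X.2 2)) • 1)
  map_add' X Y := by
    simp only [h1_add, Prod.fst_add, Prod.snd_add, Pi.add_apply, ip_add_right, add_mul', mul_add',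
      sub_mul', mul_sub', conj_add]
    exact h1_congr (by ring) (by ring) (by ring) (by module) (by module) (by module)
  map_smul' r X := by
    simp only [smul_h1, Prod.smul_fst, Prod.smul_snd, Pi.smul_apply, ip_smul_right, smul_mul',
      sub_mul', mul_sub', mul_smul', conj_smul, smul_eq_mul, RingHom.id_apply]
    exact h1_congr (by ring) (by ring) (by ring) (by module) (by module) (by module)

theorem rootLin₂_h1 (p : Octonion) (a b c : ℝ) (x y z : Octonion) :
    rootLin₂ p (h1 a b c x y z) = h1 (-2 * ip p z) (2 * ip p z) 0
    (p * (x - conj y)) ((y - conj x) * p)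
    ((b - a - 2 * ip 1 z) • p + (2 * ip p z) • 1) := rfl

theorem jordan_self_h1 (a b c : ℝ) (x y z : Octonion) :
    jordan (h1 a b c x y z) (h1 a b c x y z) =
    h1 (a ^ 2 - ip y y - ip z z) (b ^ 2 + ip x x - ip z z) (c ^ 2 + ip x x - ip y y)
      ((b + c) • x - conj (y * z)) ((c + a) • y + conj (z * x)) ((a + b) • z + conj (x * y)) :=
  jordan_self _

theorem rootLin₁_jordan_self (v : Octonion) (X : J1) :
    rootLin₁ v (jordan X X) = (2 : ℝ) • jordan (rootLin₁ v X) X := by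
  rw [← h1_eta X]
  generalize X.1 0 = a
  generalize X.1 1 = b
  generalize X.1 2 = c
  generalize X.2 0 = x
  generalize X.2 1 = y
  generalize X.2 2 = z
  rw [jordan_self_h1, rootLin₁_h1, rootLin₁_h1, jordan_h1, smul_h1]
  -- The mixed diagonal terms reduce to two trilinear forms, one in `v, x, z` and one in `v, y, z`.
  have t1 : ip (conj v) (conj x * conj z) = ip (v * conj x) z := by simp [ip]; ring
  have t2 : ip (conj z * v) x = ip (v * conj x) z := by simp [ip]; ring
  have t3 : ip (conj v * conj z) y = ip (conj y * conj v) z := by simp [ip]; ring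
  have t4 : ip v (conj z * conj y) = ip (conj y * conj v) z := by simp [ip]; ring
  have f1 := mul_mul_conj_add (conj v) y x
  have f2 := conj_mul_mul_add v x y
  have f3 := conj_mul_mul_add (conj v) y z
  have f4 := mul_mul_conj_add x v z
  simp only [conj_conj, ip_comm x v] at f1 f2 f3 f4
  simp only [ip_add_right, ip_add_left, ip_sub_left, ip_sub_right, ip_smul_left, ip_smul_right,
    t1, t2, t3, t4, conj_add, conj_sub, conj_smul, Octonion.conj_mul, conj_conj, mul_add', add_mul',
    mul_sub', sub_mul', smul_mul', mul_smul', mul_conj_mul,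
    mul_conj_mul_self]
  refine h1_congr ?_ ?_ ?_ ?_ ?_ ?_
  · ring
  · ring
  · ring
  · linear_combination (norm := module) f1
  · linear_combination (norm := module) -f2
  · linear_combination (norm := module) f4 - f3

theorem rootLin₂_jordan_self {p : Octonion} (hp : ip 1 p = 0) (X : J1) :
    rootLin₂ p (jordan X X) = (2 : ℝ) • jordan (rootLin₂ p X) X := by
  rw [← h1_eta X]
  generalize X.1 0 = a
  generalize X.1 1 = b
  generalize X.1 2 = c
  generalize X.2 0 = x
  generalize X.2 1 = y
  generalize X.2 2 = z
  rw [jordan_self_h1, rootLin₂_h1, rootLin₂_h1, jordan_h1, smul_h1]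
  have t1 : ip (p * x) x = 0 := by
    have h : p.1.re = 0 := by simpa [ip] using hp
    simp [ip, h]; ring
  have t2 : ip (y * p) y = 0 := by
    have h : p.1.re = 0 := by simpa [ip] using hp
    simp [ip, h]; ring
  have t3 : ip p (conj y * conj x) = -ip (p * conj y) x := by
    have h : p.1.re = 0 := by simpa [ip] using hp
    simp [ip, h]; ring
  have t4 : ip (conj x * p) y = ip (p * conj y) x := by
    have h : p.1.re = 0 := by simpa [ip] using hp
    simp [ip, h]; ring
  have f := conj_mul_conj_mul_imag hp x y
  rw [Octonion.conj_mul, t3] at f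
  have r1 : ip 1 (conj y * conj x) = ip 1 (x * y) := by
    rw [← Octonion.conj_mul, ← ip_conj_conj, conj_conj, conj_one]
  simp only [ip_add_right, ip_add_left, ip_sub_left, ip_smul_left, ip_smul_right,
    t1, t2, t3, t4, r1, conj_add, conj_sub, conj_smul, conj_eq_neg hp, Octonion.conj_mul, conj_conj,
    mul_add', add_mul', mul_sub', sub_mul', smul_mul', mul_smul', neg_mul', mul_neg', one_mul',
    mul_one']
  -- Moving `p` next to `x` and `y` brings both sides to the same bracketing.
  rw [imag_mul_mul hp z x, mul_mul_imag hp z y, imag_mul_conj_mul hp z (conj y),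
    mul_conj_mul_imag hp z (conj x)]
  refine h1_congr ?_ ?_ ?_ ?_ ?_ ?_
  · ring
  · ring
  · ring
  · module
  · module
  · have g1 : conj y * (y * p) = ip y y • p := conj_mul_mul_self y p
    have g2 : p * x * conj x = ip x x • p := mul_mul_conj p x
    rw [g1, g2]
    linear_combination (norm := module) f

/-- The root vector of weight one with parameter `x`, as a continuous linear map. -/
def root₁ (x : Octonion) : J1 →L[ℝ] J1 := (rootLin₁ x).toContinuousLinearMap

/-- The root vector of weight two with parameter `p`, as a continuous linear map. -/
def root₂ (p : Octonion) : J1 →L[ℝ] J1 := (rootLin₂ p).toContinuousLinearMap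

theorem A3_h1 (a b c : ℝ) (x y z : Octonion) : A3 (h1 a b c x y z) =
    h1 (-2 * ip 1 z) (2 * ip 1 z) 0 (conj y) (conj x) ((b - a) • 1) := rfl

theorem root₁_h1 (v : Octonion) (a b c : ℝ) (x y z : Octonion) :
    root₁ v (h1 a b c x y z) = h1 (-2 * ip (conj v) y) (2 * ip v x)
    (2 * ip (conj v) y - 2 * ip v x) ((c - b) • v + conj z * v)
    ((c - a) • conj v - conj v * conj z) (v * conj x + conj y * conj v) := rfl

theorem root₂_h1 (p : Octonion) (a b c : ℝ) (x y z : Octonion) :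
    root₂ p (h1 a b c x y z) = h1 (-2 * ip p z) (2 * ip p z) 0
    (p * (x - conj y)) ((y - conj x) * p)
    ((b - a - 2 * ip 1 z) • p + (2 * ip p z) • 1) := rfl

theorem h1_sub (a b c a' b' c' : ℝ) (x y z x' y' z' : Octonion) :
    h1 a b c x y z - h1 a' b' c' x' y' z' =
      h1 (a - a') (b - b') (c - c') (x - x') (y - y') (z - z') := by
  refine Prod.ext (funext fun i => ?_) (funext fun i => ?_) <;> fin_cases i <;> rfl

theorem root₁_mem (x : Octonion) : root₁ x ∈ rootSpace 1 := by
  refine ⟨leibniz_of_sq (rootLin₁ x) (rootLin₁_jordan_self x), ContinuousLinearMap.ext fun X => ?_⟩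
  change A3 (root₁ x X) - root₁ x (A3 X) = (1 : ℝ) • root₁ x X
  rw [← h1_eta X]
  have e : ∀ z : Octonion, ip 1 (x * conj z) = ip x z := fun z => by simp [ip]; ring
  have e' : ∀ z : Octonion, ip 1 (conj z * conj x) = ip (conj x) z := fun z => by
    simp [ip]; ring
  simp only [A3_h1, root₁_h1, smul_h1, h1_sub, ip_conj_conj, ip_add_right, e, e', conj_conj,
    conj_sub, conj_add, conj_smul, conj_one, Octonion.conj_mul, smul_one_mul, mul_smul_one,
    conj_eq (X.2 2), sub_mul', mul_sub']
  have e5 : ip x (conj (X.2 1)) = ip (conj x) (X.2 1) := by simp [ip]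
  have e6 := mul_conj_add x (X.2 0)
  have e7 := conj_mul_add (X.2 1) (conj x)
  rw [conj_conj, ip_comm] at e7
  refine h1_congr ?_ ?_ ?_ ?_ ?_ ?_
  · ring
  · rw [e5]; ring
  · rw [e5]; ring
  · module
  · module
  · linear_combination (norm := module) -e6 - e7

theorem root₂_mem {p : Octonion} (hp : ip 1 p = 0) : root₂ p ∈ rootSpace 2 := by
  refine ⟨leibniz_of_sq (rootLin₂ p) (rootLin₂_jordan_self hp), ContinuousLinearMap.ext fun X => ?_⟩
  change A3 (root₂ p X) - root₂ p (A3 X) = (2 : ℝ) • root₂ p X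
  rw [← h1_eta X]
  have hp' : ip p 1 = 0 := by rw [ip_comm, hp]
  simp only [A3_h1, root₂_h1, smul_h1, h1_sub, ip_add_right, ip_smul_right, hp, hp', ip_one,
    conj_conj, conj_sub, conj_eq_neg hp, Octonion.conj_mul,
    sub_mul', mul_sub', neg_mul', mul_neg']
  exact h1_congr (by ring) (by ring) (by ring) (by module) (by module) (by module)

/-! ## Exponentials -/

section Exponential

variable {E : Type*} [NormedAddCommGroup E] [NormedSpace ℝ E] [CompleteSpace E]

theorem hasSum_exp_apply (D : E →L[ℝ] E) (v : E) :
    HasSum (fun n : ℕ => (n.factorial⁻¹ : ℝ) • (D ^ n) v) (NormedSpace.exp D v) := by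
  have h := NormedSpace.exp_series_hasSum_exp' (𝕂 := ℝ) D
  simpa [Function.comp_def] using (ContinuousLinearMap.apply ℝ E v).hasSum h

theorem exp_apply_of_eigen {D : E →L[ℝ] E} {v : E} {c : ℝ} (h : D v = c • v) :
    NormedSpace.exp D v = Real.exp c • v := by
  have hn : ∀ n : ℕ, (D ^ n) v = c ^ n • v := by
    intro n
    induction n with
    | zero => simp
    | succ n ih =>
      rw [pow_succ, mul_apply_eq_comp, h, map_smul, ih, smul_smul, pow_succ']
  have h1 := hasSum_exp_apply D v
  simp only [hn, smul_smul] at h1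
  have h2 := (NormedSpace.exp_series_hasSum_exp' (𝕂 := ℝ) c).smul_const v
  rw [← Real.exp_eq_exp_ℝ] at h2
  exact h1.unique h2

theorem exp_mul_exp_neg (D : E →L[ℝ] E) : NormedSpace.exp D * NormedSpace.exp (-D) = 1 := by
  let _ : NormedAlgebra ℚ (E →L[ℝ] E) := NormedAlgebra.restrictScalars ℚ ℝ _
  rw [← NormedSpace.exp_add_of_commute (Commute.refl D).neg_right, add_neg_cancel,
    NormedSpace.exp_zero]

theorem exp_apply_of_map_eq_zero {D : E →L[ℝ] E} {v : E} (h : D v = 0) :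
    NormedSpace.exp D v = v := by
  have := exp_apply_of_eigen (D := D) (v := v) (c := 0) (by rw [h, zero_smul])
  rwa [Real.exp_zero, one_smul] at this

/-- Nilpotency is needed only at `v`. Eigenvalues of `A3` run from `-2` to `2`, so five applications
of an element of `𝔫⁺` suffice to kill any vector. -/
theorem exp_apply_of_pow_five {D : E →L[ℝ] E} {v : E} (h : D (D (D (D (D v)))) = 0) :
    NormedSpace.exp D v = v + D v + (2⁻¹ : ℝ) • D (D v) + (6⁻¹ : ℝ) • D (D (D v)) +
      (24⁻¹ : ℝ) • D (D (D (D v))) := by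
  refine HasSum.unique (hasSum_exp_apply D v) ?_
  have h5 : (D ^ 5) v = 0 := h
  have hn : ∀ n ∉ Finset.range 5, (n.factorial⁻¹ : ℝ) • (D ^ n) v = 0 := by
    intro n hn
    obtain ⟨k, rfl⟩ := Nat.exists_eq_add_of_le' (not_lt.1 (fun h => hn (Finset.mem_range.2 h)))
    rw [pow_add, mul_apply_eq_comp, h5, map_zero, smul_zero]
  have hs : HasSum (fun n : ℕ => (n.factorial⁻¹ : ℝ) • (D ^ n) v)
      (∑ n ∈ Finset.range 5, (n.factorial⁻¹ : ℝ) • (D ^ n) v) := hasSum_sum_of_ne_finset_zero hn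
  convert hs using 1
  simp [Finset.sum_range_succ, Nat.factorial]

end Exponential

/-- The Jordan product as a bilinear map. -/
def jordanBilin : J1 →ₗ[ℝ] J1 →ₗ[ℝ] J1 :=
  LinearMap.mk₂ ℝ jordan jordan_add_left (fun r X Y => jordan_smul_left r X Y)
    (fun X Y Z => jordan_add_right Y Z X) (fun r X Y => jordan_smul_right r Y X)

/-- The Jordan product as a continuous bilinear map. -/
def jordanCLM : J1 →L[ℝ] J1 →L[ℝ] J1 := jordanBilin.toContinuousBilinearMap

theorem jordanCLM_apply (X Y : J1) : jordanCLM X Y = jordan X Y := rfl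

/-- By the Leibniz rule, `s ↦ exp (-sD) (exp (sD) X ∘ exp (sD) Y)` has derivative zero; its values
at `1` and `0` are compared. -/
theorem exp_jordan {D : J1 →L[ℝ] J1} (hD : D ∈ f4) (X Y : J1) :
    NormedSpace.exp D (jordan X Y) = jordan (NormedSpace.exp D X) (NormedSpace.exp D Y) := by
  have he : ∀ (G : J1 →L[ℝ] J1) (t : ℝ), HasDerivAt (fun s : ℝ => NormedSpace.exp (s • G))
      (NormedSpace.exp (t • G) * G) t := fun G t => hasDerivAt_exp_smul_const G t
  have he' : ∀ (Z : J1) (t : ℝ), HasDerivAt (fun s : ℝ => NormedSpace.exp (s • D) Z)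
      (D (NormedSpace.exp (t • D) Z)) t := fun Z t => by
    have h := (hasDerivAt_exp_smul_const' D t).clm_apply (hasDerivAt_const t Z)
    simpa using h
  have hd : ∀ t : ℝ, HasDerivAt (fun s : ℝ => NormedSpace.exp (s • (-D))
      (jordanCLM (NormedSpace.exp (s • D) X) (NormedSpace.exp (s • D) Y))) 0 t := by
    intro t
    have h1 := (jordanCLM.hasFDerivAt.comp_hasDerivAt t (he' X t)).clm_apply (he' Y t)
    have h2 := (he (-D) t).clm_apply h1
    refine h2.congr_deriv ?_
    have := hD (NormedSpace.exp (t • D) X) (NormedSpace.exp (t • D) Y)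
    simp only [mul_apply_eq_comp, neg_apply, jordanCLM_apply, Function.comp_apply, this, map_neg,
      map_add]
    abel
  have hc := is_const_of_deriv_eq_zero (fun t => (hd t).differentiableAt)
    (fun t => (hd t).deriv) 1 0
  simp only [one_smul, zero_smul, NormedSpace.exp_zero, jordanCLM_apply, one_apply_eq_self] at hc
  have he1 : ∀ Z : J1, NormedSpace.exp D (NormedSpace.exp (-D) Z) = Z := fun Z => by
    rw [← mul_apply_eq_comp, exp_mul_exp_neg, one_apply_eq_self]
  rw [← hc, he1]

/-- The exponential of a derivation, as an element of the group. -/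
def expF4 (D : J1 →L[ℝ] J1) (hD : D ∈ f4) : F4 :=
  ⟨⟨NormedSpace.exp D, NormedSpace.exp (-D),
    exp_mul_exp_neg D, by simpa using exp_mul_exp_neg (-D)⟩, exp_jordan hD⟩

theorem nPlus_le_f4 : nPlus ≤ f4 := sup_le (fun _ h => h.1) (fun _ h => h.1)

theorem expF4_inv_mem_Nplus {D : J1 →L[ℝ] J1} (hD : D ∈ nPlus) :
    (expF4 D (nPlus_le_f4 hD))⁻¹ ∈ Nplus :=
  ⟨-D, neg_mem hD, rfl⟩

/-! ## The two fixed points of `A` -/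

/-- The point `h¹(-1, 1, 0; 0, 0, -1)` opposite to `P⁻`. -/
def Pminus' : J1 := h1 (-1) 1 0 0 0 (-1)

theorem A3_Pminus : A3 Pminus = (2 : ℝ) • Pminus := by
  rw [Pminus, A3_h1, smul_h1, ip_one, conj_zero]
  exact h1_congr (by ring) (by ring) (by ring) (by module) (by module) (by module)

theorem A3_Pminus' : A3 Pminus' = (-2 : ℝ) • Pminus' := by
  rw [Pminus', A3_h1, smul_h1, ip_neg_right, ip_one, conj_zero]
  exact h1_congr (by ring) (by ring) (by ring) (by module) (by module) (by module)

theorem h1_inj {a b c a' b' c' : ℝ} {x y z x' y' z' : Octonion} :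
    h1 a b c x y z = h1 a' b' c' x' y' z' ↔
      a = a' ∧ b = b' ∧ c = c' ∧ x = x' ∧ y = y' ∧ z = z' := by
  rw [← sub_eq_zero, h1_sub, h1_eq_zero]
  simp only [sub_eq_zero]

/-- `P⁻` spans the eigenspace of `Ã₃¹(1)` for the eigenvalue two. -/
theorem eigen_A3_two {X : J1} (h : A3 X = (2 : ℝ) • X) : X = (-X.1 0) • Pminus := by
  rw [← h1_eta X, A3_h1, smul_h1, h1_inj] at h
  obtain ⟨e1, e2, e3, f1, f2, f3⟩ := h
  have g : conj (X.2 1) = (2 : ℝ) • X.2 0 := f1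
  have g' : X.2 0 = (2 : ℝ) • conj (X.2 1) := by rw [← conj_smul, ← f2, conj_conj]
  have x0 : X.2 0 = 0 := by
    rw [g] at g'
    linear_combination (norm := module) (-(1 / 3 : ℝ)) • g'
  have y0 : X.2 1 = 0 := by
    rw [x0, conj_zero] at f2
    linear_combination (norm := module) (-(1 / 2 : ℝ)) • f2
  refine J1_ext ?_ ?_ ?_ ?_ ?_ ?_ <;>
    simp only [Prod.smul_fst, Prod.smul_snd, Pi.smul_apply, Pminus, h1, Matrix.cons_val,
      smul_eq_mul]
  · ring
  · linarith
  · linarith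
  · rw [x0, smul_zero]
  · rw [y0, smul_zero]
  · have : X.1 1 = -X.1 0 := by linarith
    rw [this] at f3
    linear_combination (norm := module) (-(1 / 2 : ℝ)) • f3

/-- On the first two octonions `A3` squares to the identity, on the span of `ξ₁, ξ₂` and the real
part of `x₃` its eigenvalues are `0, ±2`, and the rest is killed by `A3`. So nothing lies above `2`.
-/
theorem eq_zero_of_A3_eq {X : J1} {c : ℝ} (hc : 2 < c) (h : A3 X = c • X) : X = 0 := by
  rw [← h1_eta X, A3_h1, smul_h1, h1_inj] at h
  obtain ⟨e1, e2, e3, f1, f2, f3⟩ := h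
  have hc0 : c ≠ 0 := by linarith
  have k : (c ^ 2 - 4) ≠ 0 := by nlinarith
  have k1 : (c ^ 2 - 1) ≠ 0 := by nlinarith
  have g' : c • conj (X.2 1) = X.2 0 := by rw [← conj_smul, ← f2, conj_conj]
  have x0 : X.2 0 = 0 := by
    rw [f1, smul_smul] at g'
    have : (c ^ 2 - 1) • X.2 0 = 0 := by linear_combination (norm := module) g'
    exact (smul_eq_zero.1 this).resolve_left k1
  have y0 : X.2 1 = 0 := by
    rw [x0, conj_zero] at f2
    exact (smul_eq_zero.1 f2.symm).resolve_left hc0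
  have r := congrArg (ip 1) f3
  rw [ip_smul_right, ip_smul_right, ip_one] at r
  have r0 : ip 1 (X.2 2) = 0 := by
    have : (c ^ 2 - 4) * ip 1 (X.2 2) = 0 := by linear_combination -c * r + e1 - e2
    exact (mul_eq_zero.1 this).resolve_left k
  have u0 : X.1 0 = 0 := by
    rw [r0] at e1
    have : c * X.1 0 = 0 := by linarith
    exact (mul_eq_zero.1 this).resolve_left hc0
  have u1 : X.1 1 = 0 := by
    rw [r0] at e2
    have : c * X.1 1 = 0 := by linarith
    exact (mul_eq_zero.1 this).resolve_left hc0
  have u2 : X.1 2 = 0 := (mul_eq_zero.1 e3.symm).resolve_left hc0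
  have z0 : X.2 2 = 0 := by
    rw [u0, u1, sub_self, zero_smul] at f3
    exact (smul_eq_zero.1 f3.symm).resolve_left hc0
  exact J1_ext u0 u1 u2 x0 y0 z0

/-- The relation `[A3, D] = c D` makes `D P⁻` an eigenvector for `2 + c`, beyond the top of the
spectrum. -/
theorem rootSpace_Pminus {c : ℝ} (hc : 0 < c) {D : J1 →L[ℝ] J1} (hD : D ∈ rootSpace c) :
    D Pminus = 0 := by
  refine eq_zero_of_A3_eq (c := 2 + c) (by linarith) ?_
  have h := congrArg (fun T : J1 →L[ℝ] J1 => T Pminus) hD.2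
  simp only [sub_apply, mul_apply_eq_comp, smul_apply, A3_Pminus, map_smul] at h
  linear_combination (norm := module) h

theorem nPlus_Pminus {D : J1 →L[ℝ] J1} (hD : D ∈ nPlus) : D Pminus = 0 := by
  obtain ⟨D₁, h₁, D₂, h₂, rfl⟩ := Submodule.mem_sup.1 hD
  rw [add_apply, rootSpace_Pminus one_pos h₁, rootSpace_Pminus two_pos h₂, add_zero]

/-! ## The action of `N⁺` -/

/-- `Pminus'` has weight `-2` and each application of `root₁ x + root₂ p` raises weights by at least
one, so the exponential series has degree four; `d1` to `d5` are the successive powers. -/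
theorem exp_root_Pminus' (x p : Octonion) (hp : ip 1 p = 0) :
    NormedSpace.exp (root₁ x + root₂ p) Pminus' =
      h1 (-(1 + ip x x) ^ 2 - 4 * ip p p) ((1 - ip x x) ^ 2 + 4 * ip p p) (4 * ip x x)
        ((2 * ip x x - 2) • x - (4 : ℝ) • (p * x))
        ((2 + 2 * ip x x) • conj x + (4 : ℝ) • (conj x * p))
        ((-1 + 4 * ip p p + ip x x ^ 2) • 1 + (4 : ℝ) • p) := by
  have hp' : ip p 1 = 0 := by rw [ip_comm, hp]
  have q1 : ip (conj x) (conj x * p) = 0 := by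
    have h : p.1.re = 0 := by simpa [ip] using hp
    simp [ip, h]; ring
  have q2 : ip x (p * x) = 0 := by
    have h : p.1.re = 0 := by simpa [ip] using hp
    simp [ip, h]; ring
  have q3 : x * (conj x * p) = ip x x • p := mul_conj_mul x p
  have q4 : p * x * conj x = ip x x • p := mul_mul_conj p x
  have d1 : (root₁ x + root₂ p) Pminus' = h1 0 0 0 ((-2 : ℝ) • x) ((2 : ℝ) • conj x) ((4 : ℝ) • p) := by
    rw [Pminus', add_apply, root₁_h1, root₂_h1, h1_add]
    simp only [ip_zero, ip_neg_right, hp', ip_one, conj_zero, conj_neg, conj_one, neg_mul',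
      mul_neg', one_mul', mul_one', mul_zero', zero_mul', sub_zero]
    exact h1_congr (by ring) (by ring) (by ring) (by module) (by module) (by module)
  have d2 : (root₁ x + root₂ p) (h1 0 0 0 ((-2 : ℝ) • x) ((2 : ℝ) • conj x) ((4 : ℝ) • p)) =
      h1 (-4 * ip x x - 8 * ip p p) (-4 * ip x x + 8 * ip p p) (8 * ip x x)
        ((-8 : ℝ) • (p * x)) ((8 : ℝ) • (conj x * p)) ((8 * ip p p) • 1) := by
    rw [add_apply, root₁_h1, root₂_h1, h1_add]
    simp only [ip_smul_right, ip_conj, hp, conj_smul, conj_conj, conj_eq_neg hp, mul_smul',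
      smul_mul', mul_sub', sub_mul', neg_mul', mul_neg', mul_conj_self]
    exact h1_congr (by ring) (by ring) (by ring) (by module) (by module) (by module)
  have d3 : (root₁ x + root₂ p) (h1 (-4 * ip x x - 8 * ip p p) (-4 * ip x x + 8 * ip p p)
      (8 * ip x x) ((-8 : ℝ) • (p * x)) ((8 : ℝ) • (conj x * p)) ((8 * ip p p) • 1)) =
      h1 0 0 0 ((12 * ip x x) • x) ((12 * ip x x) • conj x) 0 := by
    rw [add_apply, root₁_h1, root₂_h1, h1_add]
    simp only [ip_smul_right, q1, q2, hp', ip_one, conj_smul, conj_conj, conj_one,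
      Octonion.conj_mul, conj_eq_neg hp, mul_smul', smul_mul', mul_sub', sub_mul', neg_mul',
      mul_neg', one_mul', mul_one', q3, q4]
    exact h1_congr (by ring) (by ring) (by ring) (by module) (by module) (by module)
  have d4 : (root₁ x + root₂ p) (h1 0 0 0 ((12 * ip x x) • x) ((12 * ip x x) • conj x) 0) =
      h1 (-24 * ip x x ^ 2) (24 * ip x x ^ 2) 0 0 0 ((24 * ip x x ^ 2) • 1) := by
    rw [add_apply, root₁_h1, root₂_h1, h1_add]
    simp only [ip_smul_right, ip_conj, ip_zero, conj_smul, conj_conj, conj_zero, mul_smul',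
      smul_mul', mul_sub', sub_mul', mul_conj_self, mul_zero', zero_mul']
    exact h1_congr (by ring) (by ring) (by ring) (by module) (by module) (by module)
  have d5 : (root₁ x + root₂ p) (h1 (-24 * ip x x ^ 2) (24 * ip x x ^ 2) 0 0 0
      ((24 * ip x x ^ 2) • 1)) = 0 := by
    rw [add_apply, root₁_h1, root₂_h1, h1_add, h1_eq_zero]
    simp only [ip_smul_right, ip_one, hp', ip_zero, conj_smul, conj_one, conj_zero, mul_smul',
      smul_mul', sub_zero, mul_zero', zero_mul', mul_one', one_mul']
    exact ⟨by ring, by ring, by ring, by module, by module, by module⟩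
  rw [exp_apply_of_pow_five (by rw [d1, d2, d3, d4, d5]), d1, d2, d3, d4, Pminus']
  simp only [smul_h1, h1_add]
  exact h1_congr (by ring) (by ring) (by ring) (by module) (by module) (by module)

/-- Elements of the cone are determined by three of their six coordinates. -/
theorem negCone_ext {X Y : J1} (hX : X ∈ negCone) (hY : Y ∈ negCone) (h0 : X.1 0 = Y.1 0)
    (hy : X.2 1 = Y.2 1) (hz : X.2 2 = Y.2 2) : X = Y := by
  obtain ⟨sX, nX⟩ := mem_negCone_iff.1 hX
  obtain ⟨sY, nY⟩ := mem_negCone_iff.1 hY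
  obtain ⟨tX, bX, cX⟩ := sq_zero_diag sX nX.ne
  obtain ⟨tY, bY, cY⟩ := sq_zero_diag sY nY.ne
  have eX : X.1 1 + X.1 2 = -X.1 0 := by linarith
  have eY : Y.1 1 + Y.1 2 = -X.1 0 := by linarith
  -- Vanishing trace makes `ξ₂ + ξ₃ = -ξ₁`, nonzero, so the other two diagonal entries and the first
  -- octonion are quotients by it.
  have n0 : -X.1 0 ≠ 0 := by linarith
  rw [eX] at bX cX
  rw [eY, ← hy] at bY
  rw [eY, ← hz] at cY
  rw [jordan_self, h1_eq_zero] at sX sY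
  have fX := sX.2.2.2.1
  have fY := sY.2.2.2.1
  rw [eX] at fX
  rw [eY, ← hy, ← hz] at fY
  refine J1_ext h0 (mul_right_cancel₀ n0 (by rw [← cX, cY]))
    (mul_right_cancel₀ n0 (by rw [← bX, bY])) ?_ hy hz
  exact smul_right_injective Octonion n0 ((sub_eq_zero.1 fX).trans (sub_eq_zero.1 fY).symm)

/-- The point of the cone with first coordinate `-1` and last coordinates `y`, `z`. -/
def conePt (y z : Octonion) : J1 := h1 (-1) (ip z z) (ip y y) (conj (y * z)) y z

theorem conePt_mem {y z : Octonion} (h : ip y y + ip z z = 1) : conePt y z ∈ negCone := by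
  refine mem_negCone_iff.2 ⟨?_, by simp [conePt, h1]⟩
  have hy : ip y y = 1 - ip z z := by linarith
  rw [conePt, jordan_self_h1, h1_eq_zero]
  simp only [Octonion.conj_mul, mul_conj_mul, mul_conj_mul_self, conj_smul, conj_conj, ip_conj,
    ip_mul_self, hy]
  refine ⟨by ring, by ring, by ring, by module, ?_, ?_⟩
  · module
  · module

theorem smul_mem_negCone {X : J1} {r : ℝ} (hr : 0 < r) (hX : X ∈ negCone) : r • X ∈ negCone := by
  obtain ⟨s, n⟩ := mem_negCone_iff.1 hX
  refine mem_negCone_iff.2 ⟨?_, mul_neg_of_pos_of_neg hr n⟩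
  rw [jordan_smul_left, jordan_smul_right, s, smul_zero, smul_zero]

theorem conePt_zero_one : conePt 0 1 = Pminus := by
  rw [conePt, Pminus]
  simp only [ip_one, ip_zero, zero_mul', conj_zero]

/-- Division by `-ξ₁ > 0` is the normalization. The sphere equation is the sum of the two norm
relations of `sq_zero_diag`. -/
theorem exists_eq_smul_conePt {X : J1} (hX : X ∈ negCone) :
    ∃ (y z : Octonion) (r : ℝ), ip y y + ip z z = 1 ∧ 0 < r ∧ X = r • conePt y z := by
  obtain ⟨s, n⟩ := mem_negCone_iff.1 hX
  obtain ⟨t, b, c⟩ := sq_zero_diag s n.ne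
  have n0 : -X.1 0 ≠ 0 := by linarith
  have e : ip ((-X.1 0)⁻¹ • X.2 1) ((-X.1 0)⁻¹ • X.2 1) +
      ip ((-X.1 0)⁻¹ • X.2 2) ((-X.1 0)⁻¹ • X.2 2) = 1 := by
    simp only [ip_smul_left, ip_smul_right, b, c]
    have : X.1 1 + X.1 2 = -X.1 0 := by linarith
    have n1 := n.ne
    field_simp
    linear_combination (X.1 1 + X.1 2 - X.1 0) * this
  refine ⟨_, _, -X.1 0, e, by linarith, negCone_ext hX ?_ ?_ ?_ ?_⟩
  · exact smul_mem_negCone (by linarith) (conePt_mem e)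
  · simp [conePt, h1]
  · change _ = (-X.1 0) • (-X.1 0)⁻¹ • X.2 1
    rw [smul_inv_smul₀ n0]
  · change _ = (-X.1 0) • (-X.1 0)⁻¹ • X.2 2
    rw [smul_inv_smul₀ n0]


theorem Pminus'_mem : Pminus' ∈ negCone := by
  have h : conePt 0 (-1) = Pminus' := by
    rw [conePt, Pminus']
    simp only [ip_neg_right, ip_comm (-1), ip_one, ip_zero, zero_mul', conj_zero, neg_neg]
  rw [← h]
  exact conePt_mem (by rw [ip_neg_right, ip_comm (-1), ip_neg_right, ip_one, ip_zero]; ring)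

/-- `exp 𝔫⁺` moves the point opposite to `P⁻` to every other point of the boundary. -/
theorem exists_exp_Pminus' {y z : Octonion} (h : ip y y + ip z z = 1) (hz : z ≠ 1) :
    ∃ D ∈ nPlus, ∃ r : ℝ, 0 < r ∧ NormedSpace.exp D Pminus' = r • conePt y z := by
  have hd : ip (1 - z) (1 - z) = 1 - 2 * ip 1 z + ip z z := by
    rw [ip_sub_left, ip_sub_right, ip_sub_right, ip_one, ip_comm z 1]; ring
  have hd0 : 1 - 2 * ip 1 z + ip z z ≠ 0 := by
    rw [← hd]
    exact fun h0 => hz (sub_eq_zero.1 (eq_zero_of_ip_self h0)).symm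
  have hdp : 0 < 1 - 2 * ip 1 z + ip z z :=
    lt_of_le_of_ne (hd ▸ ip_self_nonneg (1 - z)) hd0.symm
  set d := 1 - 2 * ip 1 z + ip z z with hdd
  have hy : ip y y = 1 - ip z z := by linarith
  set x : Octonion := d⁻¹ • conj (y * (1 - z)) with hx
  set p : Octonion := d⁻¹ • (z - ip 1 z • 1) with hpd
  have hp : ip 1 p = 0 := by
    rw [hpd, ip_smul_right, ip_sub_right, ip_smul_right, ip_one]; ring
  have hxx : ip x x = (1 - ip z z) / d := by
    rw [hx, ip_smul_left, ip_smul_right, ip_conj, ip_mul_self, hd, hy]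
    field_simp
  have hpp : ip p p = (ip z z - ip 1 z ^ 2) / d ^ 2 := by
    rw [hpd, ip_smul_left, ip_smul_right, ip_sub_left, ip_sub_right, ip_sub_right, ip_smul_right,
      ip_smul_left, ip_smul_right, ip_smul_left, ip_one, ip_comm z 1]
    field_simp
    ring
  have hD : root₁ x + root₂ p ∈ nPlus :=
    Submodule.add_mem_sup (root₁_mem x) (root₂_mem hp)
  refine ⟨_, hD, 4 / d, by positivity, ?_⟩
  -- Both sides lie in the cone, so only three of the six entries have to be compared.
  refine negCone_ext (negCone_invariant (expF4 _ (nPlus_le_f4 hD)) Pminus'_mem)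
    (smul_mem_negCone (by positivity) (conePt_mem h)) ?_ ?_ ?_
  · rw [exp_root_Pminus' x p hp, hxx, hpp, conePt, smul_h1]
    change -(1 + (1 - ip z z) / d) ^ 2 - 4 * ((ip z z - ip 1 z ^ 2) / d ^ 2) = 4 / d * -1
    have : ip z z = d - 1 + 2 * ip 1 z := by rw [hdd]; ring
    rw [this]
    field_simp
    ring
  · rw [exp_root_Pminus' x p hp, hxx, conePt, smul_h1]
    change (2 + 2 * ((1 - ip z z) / d)) • conj x + (4 : ℝ) • (conj x * p) = (4 / d) • y
    have k := mul_mul_conj y (1 - z)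
    rw [hd, conj_sub, conj_one, conj_eq z, mul_sub' 1 _ (y * (1 - z)), mul_one',
      mul_sub' _ z (y * (1 - z)), mul_smul_one] at k
    rw [hx, hpd, conj_smul, conj_conj, smul_mul', mul_smul', mul_sub' z, mul_smul_one]
    have k' : y * (1 - z) * z = d • y - (1 - 2 * ip 1 z) • (y * (1 - z)) := by
      linear_combination (norm := module) k
    rw [k']
    have e : ip z z = d - 1 + 2 * ip 1 z := by rw [hdd]; ring
    rw [e]
    match_scalars <;> field_simp <;> ring
  · rw [exp_root_Pminus' x p hp, hxx, hpp, conePt, smul_h1]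
    change (-1 + 4 * ((ip z z - ip 1 z ^ 2) / d ^ 2) + ((1 - ip z z) / d) ^ 2) • (1 : Octonion) +
      (4 : ℝ) • p = (4 / d) • z
    rw [hpd]
    have e : ip z z = d - 1 + 2 * ip 1 z := by rw [hdd]; ring
    rw [e]
    match_scalars <;> field_simp <;> ring

/-! ## Stabilizers -/

theorem lin_injective {g g' : F4} (h : ∀ X, lin g X = lin g' X) : g = g' :=
  Subtype.ext (Units.ext (ContinuousLinearMap.ext h))

theorem lin_inv_apply (g : F4) (X : J1) : lin g⁻¹ (lin g X) = X := by
  rw [← lin_mul, inv_mul_cancel, lin_one]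

theorem lin_apply_inv (g : F4) (X : J1) : lin g (lin g⁻¹ X) = X := by
  rw [← lin_mul, mul_inv_cancel, lin_one]

theorem jordan_E₁ (X : J1) : jordan E₁ X =
    h1 (X.1 0) 0 0 0 ((2⁻¹ : ℝ) • X.2 1) ((2⁻¹ : ℝ) • X.2 2) := by
  conv_lhs => rw [← h1_eta X]
  rw [E₁, jordan_h1]
  simp only [ip_zero_left, zero_mul', mul_zero', conj_zero]
  exact h1_congr (by ring) (by ring) (by ring) (by module) (by module) (by module)

theorem jordan_E (X : J1) : jordan E X = X := by
  rw [← h1_eta X, E, jordan_h1]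
  simp only [ip_zero_left, zero_mul', mul_zero', conj_zero]
  exact h1_congr (by ring) (by ring) (by ring) (by module) (by module) (by module)

theorem lin_E (g : F4) : lin g E = E := by
  have h := lin_jordan g E (lin g⁻¹ E)
  rw [jordan_E, lin_apply_inv, jordan_comm, jordan_E] at h
  exact h.symm

/-- Multiplication by `E₁` has eigenvalues `0, 1/2, 1`, and `1 - 8t + 8t²` takes there the values
`1, -1, 1`. Hence whatever fixes `E₁` commutes with `σ`. -/
theorem sigma_eq (X : J1) :
    sigmaLin X = X - (8 : ℝ) • jordan E₁ X + (8 : ℝ) • jordan E₁ (jordan E₁ X) := by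
  rw [jordan_E₁, jordan_E₁]
  nth_rewrite 2 [← h1_eta X]
  rw [smul_h1, smul_h1, h1_sub, h1_add]
  change h1 _ _ _ _ _ _ = h1 _ _ _ _ _ _
  simp only [h1, Matrix.cons_val]
  exact h1_congr (by ring) (by ring) (by ring) (by module) (by module) (by module)

/-- The polynomial `2t² - t` vanishes at `0` and `1/2` and is `1` at `1`, so it gives the projection
onto the line of `E₁`. -/
theorem coord_smul_E₁ (X : J1) :
    X.1 0 • E₁ = (2 : ℝ) • jordan E₁ (jordan E₁ X) - jordan E₁ X := by
  rw [jordan_E₁, jordan_E₁, E₁, smul_h1, smul_h1, h1_sub]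
  simp only [h1, Matrix.cons_val]
  exact h1_congr (by ring) (by ring) (by ring) (by module) (by module) (by module)

theorem lin_coord_of_mem_Spin9 {k : F4} (hk : k ∈ Spin9) (X : J1) : (lin k X).1 0 = X.1 0 := by
  have hk' : lin k E₁ = E₁ := hk
  have h : lin k (X.1 0 • E₁) = (lin k X).1 0 • E₁ := by
    rw [coord_smul_E₁, coord_smul_E₁, map_sub, map_smul, lin_jordan, lin_jordan, hk']
  rw [map_smul, hk'] at h
  have := congrArg (fun Z : J1 => Z.1 0) h.symm
  simpa [E₁, h1] using this

theorem lin_sigmaLin_of_mem_Spin9 {k : F4} (hk : k ∈ Spin9) (X : J1) :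
    lin k (sigmaLin X) = sigmaLin (lin k X) := by
  have hk' : lin k E₁ = E₁ := hk
  rw [sigma_eq, sigma_eq, map_add, map_sub, map_smul, map_smul, lin_jordan, lin_jordan,
    lin_jordan, hk']

theorem Spin9_le_K : Spin9 ≤ K := by
  intro k hk
  change sigma * k * sigma⁻¹ = k
  rw [mul_inv_eq_iff_eq_mul]
  exact lin_injective fun X => (lin_sigmaLin_of_mem_Spin9 hk X).symm

/-- This exhibits `A3` as an inner derivation, built from `E₁` and `F₃ 1` alone; automorphisms
fixing these two elements therefore commute with it. -/
theorem A3_eq (X : J1) : A3 X =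
    (4 : ℝ) • (jordan E₁ (jordan (F₃ 1) X) - jordan (F₃ 1) (jordan E₁ X)) := by
  rw [jordan_E₁, jordan_E₁, ← h1_eta X, F₃, jordan_h1, jordan_h1, A3_h1, h1_sub, smul_h1]
  simp only [h1, Matrix.cons_val]
  simp only [ip_zero_left, ip_smul_right, zero_mul', mul_zero', mul_one', one_mul', conj_zero,
    conj_smul]
  exact h1_congr (by ring) (by ring) (by ring) (by module) (by module) (by module)

theorem Spin7_le_Spin9 : Spin7 ≤ Spin9 := inf_le_left.trans (inf_le_left.trans inf_le_left)

theorem Spin7_le_M {k : F4} (hk : k ∈ Spin7) : k ∈ M := by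
  have h1 : k ∈ Spin9 := Spin7_le_Spin9 hk
  refine ⟨Spin9_le_K h1, ContinuousLinearMap.ext fun X => ?_⟩
  have hE : lin k E₁ = E₁ := h1
  have hF : lin k (F₃ 1) = F₃ 1 := hk.2
  change lin k (A3 (lin k⁻¹ X)) = A3 X
  rw [A3_eq, A3_eq, map_smul, map_sub, lin_jordan, lin_jordan, lin_jordan, lin_jordan, hE, hF,
    lin_apply_inv]

theorem jordan_Pminus_Pminus' : jordan Pminus Pminus' = (2 : ℝ) • (E₁ + E₂) := by
  rw [Pminus, Pminus', jordan_h1, E₁, E₂, h1_add, smul_h1]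
  simp only [ip_zero, ip_neg_right, ip_one, mul_zero', zero_mul', conj_zero]
  exact h1_congr (by ring) (by ring) (by ring) (by module) (by module) (by module)

theorem Pminus_add_Pminus' : Pminus + Pminus' = (2 : ℝ) • (E₂ - E₁) := by
  rw [Pminus, Pminus', E₁, E₂, h1_add, h1_sub, smul_h1]
  exact h1_congr (by ring) (by ring) (by ring) (by module) (by module) (by module)

theorem Pminus_sub_Pminus' : Pminus - Pminus' = (2 : ℝ) • F₃ 1 := by
  rw [Pminus, Pminus', F₃, h1_sub, smul_h1]
  exact h1_congr (by ring) (by ring) (by ring) (by module) (by module) (by module)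

/-- The product, sum and difference of the two vectors yield `E₁ + E₂`, `E₂ - E₁` and `F₃ 1`; the
unit supplies `E₃`. -/
theorem mem_Spin7_of_fix {g : F4} (h : lin g Pminus = Pminus) (h' : lin g Pminus' = Pminus') :
    g ∈ Spin7 := by
  have a : lin g ((2 : ℝ) • (E₁ + E₂)) = (2 : ℝ) • (E₁ + E₂) := by
    rw [← jordan_Pminus_Pminus', lin_jordan, h, h']
  have b : lin g ((2 : ℝ) • (E₂ - E₁)) = (2 : ℝ) • (E₂ - E₁) := by
    rw [← Pminus_add_Pminus', map_add, h, h']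
  have c : lin g ((2 : ℝ) • F₃ 1) = (2 : ℝ) • F₃ 1 := by
    rw [← Pminus_sub_Pminus', map_sub, h, h']
  have e := lin_E g
  have hE : E = E₁ + E₂ + E₃ := by
    rw [E, E₁, E₂, E₃, h1_add, h1_add]
    exact h1_congr (by ring) (by ring) (by ring) (by module) (by module) (by module)
  rw [hE, map_add, map_add] at e
  rw [map_smul, map_add] at a
  rw [map_smul, map_sub] at b
  rw [map_smul] at c
  refine ⟨⟨⟨?_, ?_⟩, ?_⟩, ?_⟩
  · change lin g E₁ = E₁
    linear_combination (norm := module) (1 / 4 : ℝ) • a - (1 / 4 : ℝ) • b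
  · change lin g E₂ = E₂
    linear_combination (norm := module) (1 / 4 : ℝ) • a + (1 / 4 : ℝ) • b
  · change lin g E₃ = E₃
    linear_combination (norm := module) e - (1 / 2 : ℝ) • a
  · change lin g (F₃ 1) = F₃ 1
    linear_combination (norm := module) (1 / 2 : ℝ) • c

/-- The idempotent `E₁ + E₂` is half of `P⁻ ∘ Pminus'`, so it is scaled by `s`; its image is again
idempotent, whence `s² = s`. -/
theorem fix_Pminus'_of_smul {g : F4} {s : ℝ} (hs : 0 < s) (h : lin g Pminus = Pminus)
    (h' : lin g Pminus' = s • Pminus') : lin g Pminus' = Pminus' := by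
  have a : lin g (E₁ + E₂) = s • (E₁ + E₂) := by
    have := lin_jordan g Pminus Pminus'
    rw [h, h', jordan_smul_right, jordan_Pminus_Pminus', map_smul] at this
    linear_combination (norm := module) (1 / 2 : ℝ) • this
  have e : jordan (E₁ + E₂) (E₁ + E₂) = E₁ + E₂ := by
    rw [E₁, E₂, h1_add, jordan_self_h1]
    simp only [ip_zero, add_zero, mul_zero', conj_zero]
    exact h1_congr (by ring) (by ring) (by ring) (by module) (by module) (by module)
  have b := lin_jordan g (E₁ + E₂) (E₁ + E₂)
  rw [e, a, jordan_smul_left, jordan_smul_right, e] at b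
  have c := congrArg (fun Z : J1 => Z.1 0) b
  simp [E₁, E₂, h1] at c
  have : s = 1 := (mul_right_cancel₀ hs.ne' (by linarith) : s = 1)
  rw [h', this, one_smul]

/-! ### The stabilizers of `[P⁻]` in `Spin(9)` and in the full group -/

theorem smul_ptP_eq_cls {g : F4} {X : negCone} :
    g • ptP = cls X ↔ ∃ r : ℝ, 0 < r ∧ X.val = r • lin g Pminus :=
  Quotient.eq (r := raySetoid)

theorem smul_ptP_eq {g : F4} : g • ptP = ptP ↔ ∃ r : ℝ, 0 < r ∧ lin g Pminus = r • Pminus := by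
  refine (smul_ptP_eq_cls (X := ⟨Pminus, Pminus_mem⟩)).trans ⟨?_, ?_⟩ <;> rintro ⟨r, hr, h⟩
  · have h' : Pminus = r • lin g Pminus := h
    exact ⟨r⁻¹, inv_pos.2 hr, by rw [eq_inv_smul_iff₀ hr.ne', ← h']⟩
  · exact ⟨r⁻¹, inv_pos.2 hr, by rw [h, inv_smul_smul₀ hr.ne']⟩

/-- Preservation of the first coordinate upgrades a fixed ray to a fixed vector, and commuting with
`σ` transfers this to `Pminus' = σ P⁻`. -/
theorem Spin9_smul_ptP_eq {k : F4} (hk : k ∈ Spin9) : k • ptP = ptP ↔ k ∈ Spin7 := by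
  rw [smul_ptP_eq]
  constructor
  · rintro ⟨r, -, h⟩
    have h0 := lin_coord_of_mem_Spin9 hk Pminus
    rw [h] at h0
    have hr : r = 1 := by
      simp [Pminus, h1] at h0
      exact h0
    rw [hr, one_smul] at h
    refine mem_Spin7_of_fix h ?_
    have hs : sigmaLin Pminus = Pminus' := by
      rw [Pminus, Pminus']
      change h1 _ _ _ _ _ _ = _
      simp only [h1, Matrix.cons_val, neg_zero]
    rw [← hs, lin_sigmaLin_of_mem_Spin9 hk, h]
  · intro h
    have a : lin k E₁ = E₁ := hk
    have b : lin k E₂ = E₂ := h.1.1.2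
    have c : lin k (F₃ 1) = F₃ 1 := h.2
    have e : Pminus = E₂ - E₁ + F₃ 1 := by
      rw [Pminus, E₁, E₂, F₃, h1_sub, h1_add]
      exact h1_congr (by ring) (by ring) (by ring) (by module) (by module) (by module)
    refine ⟨1, one_pos, ?_⟩
    rw [e, map_add, map_sub, a, b, c, one_smul]

theorem mem_MAN_of_smul_eq {g : F4} (hg : g • ptP = ptP) : g ∈ M * A * Nplus := by
  obtain ⟨c, hc, hP⟩ := smul_ptP_eq.1 hg
  obtain ⟨y, z, r, hyz, hr, hX⟩ := exists_eq_smul_conePt (negCone_invariant g⁻¹ Pminus'_mem)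
  -- Otherwise `g⁻¹ Pminus'` is on the ray of `P⁻`, which `g` preserves, and `Pminus'` would lie on
  -- that ray.
  have hz : z ≠ 1 := by
    rintro rfl
    have hy : y = 0 := eq_zero_of_ip_self (by rw [ip_one] at hyz; linarith)
    rw [hy, conePt_zero_one] at hX
    have h := lin_apply_inv g Pminus'
    rw [hX, map_smul, hP, smul_smul, Pminus, Pminus', smul_h1, h1_inj] at h
    obtain ⟨h1, -, -, -, -, h2⟩ := h
    have h3 : r * c = 1 := by linarith
    rw [h3, one_smul] at h2
    have := congrArg (ip 1) h2
    rw [ip_neg_right, ip_one] at this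
    norm_num at this
  obtain ⟨D, hD, s, hs, he⟩ := exists_exp_Pminus' hyz hz
  set n := expF4 D (nPlus_le_f4 hD) with hn
  -- The eigenvalue of `A3` on `P⁻` is `2`, so this parameter makes the exponential scale `P⁻` by
  -- `c`.
  have hA : (Real.log c / 2) • A3 ∈ f4 := Submodule.smul_mem _ _ A3_mem
  set a := expF4 _ hA with ha
  have nP : lin n Pminus = Pminus := exp_apply_of_map_eq_zero (nPlus_Pminus hD)
  have nQ : lin n Pminus' = (s / r) • lin g⁻¹ Pminus' := by
    rw [hX, smul_smul, div_mul_cancel₀ _ hr.ne']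
    exact he
  have aP : lin a⁻¹ Pminus = c⁻¹ • Pminus := by
    have : lin a Pminus = c • Pminus := by
      have h := exp_apply_of_eigen (D := (Real.log c / 2) • A3) (v := Pminus) (c := Real.log c)
        (by rw [smul_apply, A3_Pminus, smul_smul, div_mul_cancel₀ _ two_ne_zero])
      rwa [Real.exp_log hc] at h
    rw [eq_inv_smul_iff₀ hc.ne', ← map_smul, ← this, lin_inv_apply]
  have aQ : lin a⁻¹ Pminus' = c • Pminus' := by
    have : lin a Pminus' = c⁻¹ • Pminus' := by
      have h := exp_apply_of_eigen (D := (Real.log c / 2) • A3) (v := Pminus') (c := -Real.log c)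
        (by rw [smul_apply, A3_Pminus', smul_smul]; congr 1; ring)
      rwa [Real.exp_neg, Real.exp_log hc] at h
    have h := lin_inv_apply a Pminus'
    rw [this, map_smul, inv_smul_eq_iff₀ hc.ne'] at h
    exact h
  have mP : lin (g * n * a⁻¹) Pminus = Pminus := by
    rw [lin_mul, lin_mul, aP, map_smul, nP, map_smul, hP, inv_smul_smul₀ hc.ne']
  have mQ : lin (g * n * a⁻¹) Pminus' = (c * (s / r)) • Pminus' := by
    rw [lin_mul, lin_mul, aQ, map_smul, nQ, map_smul, map_smul, lin_apply_inv, smul_smul]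
  have mQ' := fix_Pminus'_of_smul (by positivity) mP mQ
  refine ⟨g * n * a⁻¹ * a, ⟨_, Spin7_le_M (mem_Spin7_of_fix mP mQ'), a, ⟨_, rfl⟩, rfl⟩, n⁻¹,
    expF4_inv_mem_Nplus hD, ?_⟩
  group

theorem smul_eq_of_mem_MAN {g : F4} (hg : g ∈ M * A * Nplus) : g • ptP = ptP := by
  obtain ⟨_, ⟨m, hm, a, ⟨t, ha⟩, rfl⟩, n, ⟨D, hD, hn⟩, rfl⟩ := hg
  have h1 : n • ptP = ptP := smul_ptP_eq.2
    ⟨1, one_pos, by rw [hn, exp_apply_of_map_eq_zero (nPlus_Pminus hD), one_smul]⟩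
  have h2 : a • ptP = ptP := smul_ptP_eq.2 ⟨Real.exp (t * 2), Real.exp_pos _, by
    rw [ha]
    exact exp_apply_of_eigen (by rw [smul_apply, A3_Pminus, smul_smul])⟩
  -- Commuting with `A3`, `m` keeps `P⁻` in its one-dimensional eigenspace; invariance of the cone
  -- makes the factor positive.
  have h3 : m • ptP = ptP := by
    have e : A3 (lin m Pminus) = (2 : ℝ) • lin m Pminus := by
      have := congrArg (fun T : J1 →L[ℝ] J1 => T (lin m Pminus)) hm.2
      simp only [mul_apply_eq_comp, lin_inv_apply, A3_Pminus, map_smul] at this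
      exact this.symm
    exact smul_ptP_eq.2 ⟨_, by
      have := (mem_negCone_iff.1 (negCone_invariant m Pminus_mem)).2
      linarith, eigen_A3_two e⟩
  change (m * a * n) • ptP = ptP
  rw [mul_smul, mul_smul, h1, h2, h3]

theorem stabilizer_ptP : (MulAction.stabilizer F4 ptP : Set F4) = M * A * Nplus :=
  Set.Subset.antisymm (fun _ h => mem_MAN_of_smul_eq h) (fun _ h => smul_eq_of_mem_MAN h)

/-! ## Continuity -/

/-- The multiplication of the octonions as a bilinear map. -/
def mulBilin : Octonion →ₗ[ℝ] Octonion →ₗ[ℝ] Octonion :=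
  LinearMap.mk₂ ℝ (· * ·) add_mul' smul_mul' (fun x y z => mul_add' y z x)
    (fun r x y => mul_smul' r x y)

/-- The inner product of the octonions as a bilinear map. -/
def ipBilin : Octonion →ₗ[ℝ] Octonion →ₗ[ℝ] ℝ :=
  LinearMap.mk₂ ℝ ip ip_add_left ip_smul_left (fun x y z => ip_add_right y z x)
    (fun r x y => ip_smul_right r x y)

/-- The conjugation of the octonions as a linear map. -/
def conjLin : Octonion →ₗ[ℝ] Octonion where
  toFun := conj
  map_add' := conj_add
  map_smul' := conj_smul

section Continuity

variable {T : Type*} [TopologicalSpace T]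

theorem continuous_octonion_mul {f g : T → Octonion} (hf : Continuous f) (hg : Continuous g) :
    Continuous fun t => f t * g t :=
  (mulBilin.toContinuousBilinearMap.continuous.comp hf).clm_apply hg

theorem continuous_ip {f g : T → Octonion} (hf : Continuous f) (hg : Continuous g) :
    Continuous fun t => ip (f t) (g t) :=
  (ipBilin.toContinuousBilinearMap.continuous.comp hf).clm_apply hg

theorem continuous_conj {f : T → Octonion} (hf : Continuous f) : Continuous fun t => conj (f t) :=
  conjLin.continuous_of_finiteDimensional.comp hf

theorem continuous_h1 {a b c : T → ℝ} {x y z : T → Octonion} (ha : Continuous a)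
    (hb : Continuous b) (hc : Continuous c) (hx : Continuous x) (hy : Continuous y)
    (hz : Continuous z) : Continuous fun t => h1 (a t) (b t) (c t) (x t) (y t) (z t) := by
  refine Continuous.prodMk (continuous_pi fun i => ?_) (continuous_pi fun i => ?_)
  · fin_cases i <;> assumption
  · fin_cases i <;> assumption

theorem continuous_refl {l : T → ℝ} {v : T → Octonion} (hl : Continuous l) (hv : Continuous v)
    (h : ∀ t, l t ^ 2 + ip (v t) (v t) = 1) : Continuous fun t => refl (l t) (v t) (h t) := by
  have hc : Continuous fun t => (reflLin (l t) (v t)).toContinuousLinearMap := by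
    rw [continuous_clm_apply]
    intro X
    have hi := continuous_ip hv (continuous_const (y := X.2 0))
    have hs : Continuous fun t => l t * (X.1 1 - X.1 2) + 2 * ip (v t) (X.2 0) := by fun_prop
    refine continuous_h1 continuous_const (by fun_prop) (by fun_prop) (by fun_prop) ?_ ?_
    · exact (continuous_conj (continuous_octonion_mul continuous_const hv)).sub
        (hl.smul continuous_const)
    · exact (hl.smul continuous_const).add
        (continuous_conj (continuous_octonion_mul hv continuous_const))
  -- A reflection is its own inverse, so one continuity proof covers the unit and its inverse.
  exact Continuous.subtype_mk (Units.continuous_iff.2 ⟨hc, hc⟩) _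

end Continuity

theorem continuous_lin_apply (X : J1) : Continuous fun g : F4 => lin g X :=
  (Units.continuous_val.comp continuous_subtype_val).clm_apply continuous_const

theorem isQuotientMap_cls : Topology.IsQuotientMap cls := isQuotientMap_quotient_mk'

theorem continuous_smul_ptP : Continuous fun g : F4 => g • ptP :=
  isQuotientMap_cls.continuous.comp
    (Continuous.subtype_mk (continuous_lin_apply Pminus) fun g => negCone_invariant g Pminus_mem)

/-! ## Local sections of the orbit map -/

/-- The inner reflection sends `P⁻` to the normalized point with last octonions `-y/|y|` and `0`;
the outer one, with `c = |y| / (-ξ₁)` and vector `-x/|y|`, moves it to the ray of `X`. The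
parameters depend continuously on `X` where `y ≠ 0`. -/
theorem refl_apply_of_ne {X : J1} (hX : X ∈ negCone) (hy : X.2 1 ≠ 0) :
    0 < √(ip (X.2 1) (X.2 1)) ∧
    (√(ip (X.2 1) (X.2 1)) / -X.1 0) ^ 2 + ip ((-(√(ip (X.2 1) (X.2 1)))⁻¹) • X.2 0)
      ((-(√(ip (X.2 1) (X.2 1)))⁻¹) • X.2 0) = 1 ∧
    (0 : ℝ) ^ 2 + ip ((-(√(ip (X.2 1) (X.2 1)))⁻¹) • conj (X.2 1))
      ((-(√(ip (X.2 1) (X.2 1)))⁻¹) • conj (X.2 1)) = 1 ∧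
    (-X.1 0) • reflLin (√(ip (X.2 1) (X.2 1)) / -X.1 0) ((-(√(ip (X.2 1) (X.2 1)))⁻¹) • X.2 0)
      (reflLin 0 ((-(√(ip (X.2 1) (X.2 1)))⁻¹) • conj (X.2 1)) Pminus) = X := by
  obtain ⟨hs, hn⟩ := mem_negCone_iff.1 hX
  obtain ⟨t, b, c⟩ := sq_zero_diag hs hn.ne
  rw [jordan_self, h1_eq_zero] at hs
  have e : X.1 1 + X.1 2 = -X.1 0 := by linarith
  have a : ip (X.2 0) (X.2 0) = X.1 1 * X.1 2 := by
    have := hs.2.1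
    rw [c] at this
    linear_combination this
  have p : 0 < ip (X.2 1) (X.2 1) :=
    lt_of_le_of_ne (ip_self_nonneg _) fun h => hy (eq_zero_of_ip_self h.symm)
  have r := Real.sq_sqrt p.le
  have r0 : 0 < √(ip (X.2 1) (X.2 1)) := Real.sqrt_pos.2 p
  set r1 := √(ip (X.2 1) (X.2 1)) with hr1
  have hn' : X.1 0 ≠ 0 := hn.ne
  have hq : X.1 2 ≠ 0 := by
    rintro h
    rw [b, h, zero_mul] at p
    exact lt_irrefl _ p
  have k1 : (r1 / -X.1 0) ^ 2 + ip ((-r1⁻¹) • X.2 0) ((-r1⁻¹) • X.2 0) = 1 := by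
    rw [ip_smul_left, ip_smul_right, a]
    have : X.1 1 = -X.1 0 - X.1 2 := by linarith
    rw [e] at b
    rw [b] at r
    have h : (r1 / -X.1 0) ^ 2 + -r1⁻¹ * (-r1⁻¹ * (X.1 1 * X.1 2)) =
      r1 ^ 2 / X.1 0 ^ 2 + X.1 1 * X.1 2 / r1 ^ 2 := by field_simp
    rw [h, r, this]
    field_simp
    ring
  have k2 : (0 : ℝ) ^ 2 + ip ((-r1⁻¹) • conj (X.2 1)) ((-r1⁻¹) • conj (X.2 1)) = 1 := by
    rw [ip_smul_left, ip_smul_right, ip_conj, ← r]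
    field_simp
    ring
  refine ⟨r0, k1, k2, ?_⟩
  refine negCone_ext (smul_mem_negCone (by linarith) (negCone_invariant (refl _ _ k1)
    (negCone_invariant (refl _ _ k2) Pminus_mem))) hX ?_ ?_ ?_
  · rw [Pminus, reflLin_h1, reflLin_h1, smul_h1]
    change -X.1 0 * -1 = X.1 0
    ring
  · rw [Pminus, reflLin_h1, reflLin_h1, smul_h1]
    change (-X.1 0) • _ = X.2 1
    simp only [one_mul', conj_smul, conj_conj, mul_zero', conj_zero, zero_smul, zero_mul', sub_zero,
      zero_sub, add_zero, smul_zero, smul_neg, smul_smul]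
    rw [← neg_smul]
    convert one_smul ℝ (X.2 1) using 2
    field_simp
  · rw [Pminus, reflLin_h1, reflLin_h1, smul_h1]
    change (-X.1 0) • _ = X.2 2
    have f3 : conj (X.2 0 * X.2 1) = X.1 2 • X.2 2 := by
      rw [eq_neg_of_add_eq_zero_right hs.2.2.2.2.2, ← neg_smul]
      congr 1
      linarith
    simp only [one_mul', conj_smul, conj_conj, mul_zero', conj_zero, zero_smul, sub_zero,
      add_zero, smul_zero, zero_add, smul_smul, smul_mul', mul_smul', f3]
    convert one_smul ℝ (X.2 2) using 2
    rw [b, e] at r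
    have : X.1 0 * X.1 2 = -r1 ^ 2 := by linarith
    field_simp
    linear_combination -this

theorem smul_ptP_of_smul_lin {g : F4} {X : negCone} {r : ℝ} (hr : 0 < r)
    (h : r • lin g Pminus = X.val) : g • ptP = cls X :=
  smul_ptP_eq_cls.2 ⟨r, hr, h.symm⟩

/-- The orbit map of `Spin(9)` has continuous local sections. -/
theorem exists_local_section (X : negCone) : ∃ (U : Set negCone) (s : U → Spin9), IsOpen U ∧
    X ∈ U ∧ Continuous s ∧ ∀ u : U, (s u : F4) • ptP = cls u := by
  set U : Set negCone := {X | X.val.2 1 ≠ 0} with hU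
  have cy : Continuous fun X : negCone => X.val.2 1 := by fun_prop
  have cx : Continuous fun X : negCone => X.val.2 0 := by fun_prop
  have cq : Continuous fun X : negCone => X.val.1 0 := by fun_prop
  have hUo : IsOpen U := isOpen_ne_fun cy continuous_const
  have R := fun u : U => refl_apply_of_ne u.val.property u.property
  have cn : Continuous fun u : U => √(ip (u.val.val.2 1) (u.val.val.2 1)) :=
    (continuous_ip (cy.comp continuous_subtype_val) (cy.comp continuous_subtype_val)).sqrt
  have ci : Continuous fun u : U => -(√(ip (u.val.val.2 1) (u.val.val.2 1)))⁻¹ :=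
    (cn.inv₀ fun u => (R u).1.ne').neg
  set s : U → Spin9 := fun u => ⟨refl _ _ (R u).2.1 * refl _ _ (R u).2.2.1,
    mul_mem (refl_mem_Spin9 _ _ _) (refl_mem_Spin9 _ _ _)⟩ with hs
  have neg : ∀ X : negCone, X.val.1 0 < 0 := fun X => (mem_negCone_iff.1 X.property).2
  have sc : Continuous s := by
    refine Continuous.subtype_mk (Continuous.mul (continuous_refl ?_ ?_ _)
      (continuous_refl ?_ ?_ _)) _
    · exact cn.div (cq.comp continuous_subtype_val).neg fun u => by
        have := neg u.val
        simp only [ne_eq, neg_eq_zero]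
        exact this.ne
    · exact ci.smul (cx.comp continuous_subtype_val)
    · exact continuous_const
    · exact ci.smul (continuous_conj (cy.comp continuous_subtype_val))
  have ss : ∀ u : U, (s u : F4) • ptP = cls u := fun u =>
    smul_ptP_of_smul_lin (r := -u.val.val.1 0) (by have := neg u.val; linarith) (R u).2.2.2
  -- Where `y = 0`, the reflection with `c = 0` and vector `1` first replaces `y` by `conj z`. This
  -- is nonzero, since `y = z = 0` would force `ξ₁ = 0`.
  by_cases hy : X.val.2 1 = 0
  · have one : (0 : ℝ) ^ 2 + ip 1 1 = 1 := by rw [ip_one]; ring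
    set k : Spin9 := ⟨refl 0 1 one, refl_mem_Spin9 _ _ _⟩ with hk
    set f : negCone → negCone := fun Y => ⟨lin k Y.val, negCone_invariant k Y.property⟩ with hf
    have fc : Continuous f :=
      Continuous.subtype_mk ((lin k).continuous.comp continuous_subtype_val) _
    refine ⟨f ⁻¹' U, fun u => k⁻¹ * s ⟨f u.val, u.property⟩, hUo.preimage fc, ?_, ?_, ?_⟩
    · intro h0
      change conj (X.val.2 2 * 1) - (0 : ℝ) • X.val.2 1 = 0 at h0
      rw [zero_smul, sub_zero, mul_one'] at h0
      have hz : X.val.2 2 = 0 := by rw [← conj_conj (X.val.2 2), h0, conj_zero]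
      obtain ⟨h1, h2⟩ := mem_negCone_iff.1 X.property
      have h3 := congrArg (fun Z : J1 => Z.1 0) h1
      rw [jordan_self] at h3
      change X.val.1 0 ^ 2 - ip (X.val.2 1) (X.val.2 1) - ip (X.val.2 2) (X.val.2 2) = 0 at h3
      rw [hy, hz, ip_zero, sub_zero, sub_zero] at h3
      exact h2.ne (pow_eq_zero_iff two_ne_zero |>.1 h3)
    · exact continuous_const.mul (sc.comp
        (Continuous.subtype_mk (fc.comp continuous_subtype_val) _))
    · intro u
      change ((k : F4)⁻¹ * (s ⟨f u.val, u.property⟩ : F4)) • ptP = cls u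
      rw [mul_smul, ss, inv_smul_eq_iff]
      rfl
  · exact ⟨U, s, hUo, hy, sc, ss⟩

/-! ### From local sections to homeomorphisms -/

section Orbit

variable {G : Type*} [Group G] [TopologicalSpace G] [MulAction G Furst]

theorem isOpenMap_smul_ptP [ContinuousMul G]
    (h : ∀ X : negCone, ∃ (U : Set negCone) (s : U → G), IsOpen U ∧ X ∈ U ∧ Continuous s ∧
      ∀ u : U, s u • ptP = cls u) :
    IsOpenMap fun g : G => g • ptP := by
  intro V hV
  rw [← isQuotientMap_cls.isOpen_preimage, isOpen_iff_mem_nhds]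
  rintro X ⟨g, hg, hgX⟩
  obtain ⟨U, s, hU, hX, hs, hsu⟩ := h X
  -- Right translation by an element of the stabilizer keeps this a section and makes it pass
  -- through the given `g` at `X`.
  set t : U → G := fun u => s u * ((s ⟨X, hX⟩)⁻¹ * g) with ht
  have htc : Continuous t := hs.mul continuous_const
  have hst : ((s ⟨X, hX⟩)⁻¹ * g) • ptP = ptP := by
    have hgX' : g • ptP = cls X := hgX
    rw [mul_smul, hgX', inv_smul_eq_iff, hsu]
  have hW : IsOpen (Subtype.val '' (t ⁻¹' V)) := hU.isOpenMap_subtype_val _ (hV.preimage htc)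
  refine Filter.mem_of_superset (hW.mem_nhds ⟨⟨X, hX⟩, ?_, rfl⟩) ?_
  · change s ⟨X, hX⟩ * ((s ⟨X, hX⟩)⁻¹ * g) ∈ V
    rwa [mul_inv_cancel_left]
  · rintro _ ⟨u, hu, rfl⟩
    refine ⟨t u, hu, ?_⟩
    change (s u * _) • ptP = _
    rw [mul_smul, hst, hsu]

/-- A transitive action with open continuous orbit map identifies the quotient by the stabilizer
with the space. -/
theorem exists_homeomorph_quotient (H : Subgroup G) (hH : ∀ g : G, g • ptP = ptP ↔ g ∈ H)
    (hc : Continuous fun g : G => g • ptP) (ho : IsOpenMap fun g : G => g • ptP)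
    (hs : Function.Surjective fun g : G => g • ptP) :
    ∃ φ : (G ⧸ H) ≃ₜ Furst, ∀ g : G, φ (g : G ⧸ H) = g • ptP := by
  obtain rfl : H = MulAction.stabilizer G ptP := by
    ext g
    rw [← hH, MulAction.mem_stabilizer_iff]
  have hb : Function.Bijective (MulAction.ofQuotientStabilizer G ptP) :=
    ⟨MulAction.injective_ofQuotientStabilizer G ptP, fun x => by
      obtain ⟨g, hg⟩ := hs x
      exact ⟨g, hg⟩⟩
  refine ⟨(Equiv.ofBijective _ hb).toHomeomorphOfContinuousOpen
    (isQuotientMap_quotient_mk'.continuous_iff.2 hc) ?_, fun g => rfl⟩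
  intro V hV
  -- The image of a set of cosets is the orbit-map image of its preimage in `G`, so openness
  -- descends from the orbit map.
  have : (MulAction.ofQuotientStabilizer G ptP) '' V =
      (fun g : G => g • ptP) '' ((↑) ⁻¹' V : Set G) := by
    ext x
    constructor
    · rintro ⟨q, hq, rfl⟩
      induction q using QuotientGroup.induction_on with
      | H g => exact ⟨g, hq, rfl⟩
    · rintro ⟨g, hg, rfl⟩
      exact ⟨_, hg, rfl⟩
  change IsOpen ((MulAction.ofQuotientStabilizer G ptP) '' V)
  rw [this]
  exact ho _ (hV.preimage QuotientGroup.continuous_mk)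

end Orbit

/-! ### Transitivity and the resulting quotients -/

theorem Spin9_transitive (x : Furst) : ∃ k : Spin9, (k : F4) • ptP = x := by
  obtain ⟨X, rfl⟩ := isQuotientMap_cls.surjective x
  obtain ⟨U, s, -, hX, -, hs⟩ := exists_local_section X
  exact ⟨s ⟨X, hX⟩, hs _⟩

theorem exists_homeomorph_F4 (H : Subgroup F4) (hH : (H : Set F4) = M * A * Nplus) :
    ∃ φ : (F4 ⧸ H) ≃ₜ Furst, ∀ g : F4, φ (g : F4 ⧸ H) = g • ptP := by
  refine exists_homeomorph_quotient H (fun g => ?_) continuous_smul_ptP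
    (isOpenMap_smul_ptP fun X => ?_) fun x => ?_
  · rw [← SetLike.mem_coe, hH, ← stabilizer_ptP]
    rfl
  · obtain ⟨U, s, hU, hX, hs, hsu⟩ := exists_local_section X
    exact ⟨U, fun u => s u, hU, hX, continuous_subtype_val.comp hs, hsu⟩
  · obtain ⟨k, hk⟩ := Spin9_transitive x
    exact ⟨k, hk⟩

theorem exists_homeomorph_Spin9 :
    ∃ ψ : (Spin9 ⧸ Spin7.subgroupOf Spin9) ≃ₜ Furst, ∀ k : Spin9,
      ψ (k : Spin9 ⧸ Spin7.subgroupOf Spin9) = (k : F4) • ptP :=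
  exists_homeomorph_quotient (G := Spin9) (Spin7.subgroupOf Spin9)
    (fun k => Spin9_smul_ptP_eq k.property) (continuous_smul_ptP.comp continuous_subtype_val)
    (isOpenMap_smul_ptP exists_local_section) Spin9_transitive

theorem orbit_K_ptP : MulAction.orbit K ptP = Set.univ := by
  refine Set.eq_univ_of_forall fun x => ?_
  obtain ⟨k, hk⟩ := Spin9_transitive x
  exact ⟨⟨k, Spin9_le_K k.property⟩, hk⟩

end ExcF4

end

theorem theorem9p5 :
    -- the stabilizer of `[P⁻]` is `M A N⁺`
    (MulAction.stabilizer ExcF4.F4 ExcF4.ptP : Set ExcF4.F4) =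
      ExcF4.M * ExcF4.A * ExcF4.Nplus ∧
    -- `M A N⁺` is a subgroup, and `F₄₍₋₂₀₎ / M A N⁺ ≃ ℱ`
    (∃ H : Subgroup ExcF4.F4, (H : Set ExcF4.F4) = ExcF4.M * ExcF4.A * ExcF4.Nplus ∧
      ∃ φ : (ExcF4.F4 ⧸ H) ≃ₜ ExcF4.Furst, ∀ g : ExcF4.F4, φ (g : ExcF4.F4 ⧸ H) = g • ExcF4.ptP) ∧
    -- `ℱ` is a single `K`-orbit
    MulAction.orbit ExcF4.K ExcF4.ptP = Set.univ ∧
    -- `ℱ ≃ Spin(9) / Spin(7)`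
    (ExcF4.Spin7 ≤ ExcF4.Spin9 ∧
      ∃ ψ : (ExcF4.Spin9 ⧸ ExcF4.Spin7.subgroupOf ExcF4.Spin9) ≃ₜ ExcF4.Furst,
        ∀ k : ExcF4.Spin9,
          ψ (k : ExcF4.Spin9 ⧸ ExcF4.Spin7.subgroupOf ExcF4.Spin9) = (k : ExcF4.F4) • ExcF4.ptP) :=
  ⟨ExcF4.stabilizer_ptP,
    ⟨MulAction.stabilizer ExcF4.F4 ExcF4.ptP, ExcF4.stabilizer_ptP,
      ExcF4.exists_homeomorph_F4 _ ExcF4.stabilizer_ptP⟩,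
    ExcF4.orbit_K_ptP, ExcF4.Spin7_le_Spin9, ExcF4.exists_homeomorph_Spin9⟩
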